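/- Let $\Pi=\{z\in\mathbb C:\operatorname{Im}z>0\}$ and $\tau\in\mathbb R=\partial\Pi$. For $\lambda:[0,\infty)\to[0,\infty)$ the $\lambda$-Stolz region at $\tau$ is $$S^\lambda_\tau=\Big\{z\in\Pi:\ \operatorname{dist}(z,\partial\Pi)\ge\lambda(c)\ \text{and}\ \sqrt{|z-\tau|^2-\operatorname{dist}(z,\partial\Pi)^2}\le c\ \text{ for some } c>0\Big\},$$ and $B(\tau,r)$ is the open disc of radius $r$ about $\tau$. The Nevanlinna measure $\mu_f$ of an analytic function $f:\Pi\to\overline\Pi$ is the locally finite Borel measure on $\mathbb R$ that is the limit, tested against continuous functions of compact support, of the measures $\operatorname{Im}f(x+iy)\,dx$ as $y\downarrow0$. Let $\gamma:[0,\infty)\to[0,\infty)$ be monotone increasing (not necessarily strictly), with $\gamma(t)>0$ for $t>0$ and $\gamma(t)=O(t^2)$ as $t\downarrow0$. Such an $f$ is called $\gamma$-regular at $\tau$ if for some $C>0$ the function $t\mapsto 1/\gamma(C|t-\tau|)$ (with $1/0=\infty$) is $\mu_f$-integrable on a neighborhood of $\tau$. A number $f(\tau)\in\mathbb{C}$ is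 the nontangential value of $f$ at $\tau$ if $f(z)\to f(\tau)$ as $z\to\tau$ within $\{z\in\Pi:\operatorname{dist}(z,\partial\Pi)\ge M|z-\tau|\}$, for every $M>0$. 1. Every analytic $f:\Pi\to\overline\Pi$ that is $\gamma$-regular at $\tau$ is $\gamma$-horocyclically continuous at $\tau$; that is, the nontangential value $f(\tau)$ exists, and there is a $C>0$ such that $$\sup_{z\in S^{D\gamma(Ct)}_\tau\cap B(\tau,1/D)}|f(z)-f(\tau)|<\infty\quad\text{for every }D>0,$$ $$\lim_{D\to\infty}\ \sup_{z\in S^{D\gamma(Ct)}_\tau\cap B(\tau,1/D)}|f(z)-f(\tau)|=0 .$$ 2. Conversely, for every $\lambda:[0,\infty)\to[0,\infty)$ such that, for some $C>0$, $\lambda(t)=o(\gamma(Ct))$ as $t\downarrow0$, there is an analytic $f:\Pi\to\overline\Pi$, $\gamma$-regular at $\tau$ and with a nontangential value $f(\tau)$, such that $$\sup_{z\in S^\lambda_\tau}|f(z)-f(\tau)|=\infty,$$ and this happens arbitrarily close to $\tau$: $\sup_{z\in S^\lambda_\tau\cap B(\tau,r)}|f(z)-f(\tau)|=\infty$ for every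 $r>0$. -/

import Mathlib

open Set Filter Topology MeasureTheory Asymptotics UpperHalfPlane
open scoped NNReal ENNReal

noncomputable section

namespace Horocyclic

/-- `f` is an analytic function from the open upper half plane `Π` to its closure
(only the values of `f` on `Π` matter). -/
structure IsPick (f : ℂ → ℂ) : Prop where
  analytic : DifferentiableOn ℂ f upperHalfPlaneSet
  mapsTo : MapsTo f upperHalfPlaneSet (closure upperHalfPlaneSet)

/-- `μ` is the Nevanlinna measure of `f`: a locally finite Borel measure on `ℝ` which is the
weak limit (tested against continuous functions of compact support) of the measures
`Im f(x + i y) dx` as `y` decreases to `0`. -/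
structure IsNevanlinnaMeasure (f : ℂ → ℂ) (μ : Measure ℝ) : Prop where
  locallyFinite : IsLocallyFiniteMeasure μ
  tendsto : ∀ φ : ℝ → ℝ, Continuous φ → HasCompactSupport φ →
    Tendsto (fun y : ℝ => ∫ x : ℝ, φ x * (f (x + y * Complex.I)).im) (𝓝[>] 0)
      (𝓝 (∫ x, φ x ∂μ))

/-- `f` is `γ`-regular at `τ`: for some `C > 0`, the function `1 / γ (C |t - τ|)` is integrable
with respect to the Nevanlinna measure on a neighborhood of `τ`.
The reciprocal is taken in `[0, ∞]`, so that `1 / 0 = ∞`. -/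
def IsRegularAt (γ : ℝ≥0 → ℝ≥0) (f : ℂ → ℂ) (τ : ℝ) : Prop :=
  ∃ μ : Measure ℝ, IsNevanlinnaMeasure f μ ∧
    ∃ C : ℝ≥0, 0 < C ∧ ∃ U ∈ 𝓝 τ, ∫⁻ t in U, (γ (C * nndist t τ) : ℝ≥0∞)⁻¹ ∂μ < ∞

/-- The Stolz region with aperture `M` in the domain `Ω` at the boundary point `τ`. -/
def stolzRegion (Ω : Set ℂ) (τ : ℂ) (M : ℝ) : Set ℂ :=
  {z ∈ Ω | M * dist z τ ≤ Metric.infDist z (frontier Ω)}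

/-- The `lam`-Stolz region in the domain `Ω` at the boundary point `τ`. -/
def lamStolzRegion (Ω : Set ℂ) (τ : ℂ) (lam : ℝ≥0 → ℝ≥0) : Set ℂ :=
  {z ∈ Ω | ∃ c : ℝ≥0, 0 < c ∧ (lam c : ℝ) ≤ Metric.infDist z (frontier Ω) ∧
    Real.sqrt (dist z τ ^ 2 - Metric.infDist z (frontier Ω) ^ 2) ≤ c}

/-- `w` is the nontangential value of `f` at `τ`: `f z` tends to `w` as `z` tends to `τ` inside
each Stolz region of positive aperture in the upper half plane. -/
def HasNontangentialValue (f : ℂ → ℂ) (τ : ℝ) (w : ℂ) : Prop :=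
  ∀ M : ℝ, 0 < M → Tendsto f (𝓝[stolzRegion upperHalfPlaneSet τ M] (τ : ℂ)) (𝓝 w)

/-- The supremum of `|f - w|` over `S`, as an element of `[0, ∞]`. -/
def supDist (f : ℂ → ℂ) (w : ℂ) (S : Set ℂ) : ℝ≥0∞ := ⨆ z ∈ S, ‖f z - w‖ₑ

/-- The intersection of the `D γ(C t)`-Stolz region of the upper half plane at `τ` with the
ball `B(τ, 1 / D)`. -/
def horoRegion (γ : ℝ≥0 → ℝ≥0) (τ : ℝ) (C D : ℝ≥0) : Set ℂ :=
  lamStolzRegion upperHalfPlaneSet τ (fun t => D * γ (C * t)) ∩ Metric.ball (τ : ℂ) (1 / D)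

/-- `f` is `γ`-horocyclically continuous at `τ`, where `f(τ)` is the nontangential value. -/
def IsHorocyclicallyContinuousAt (γ : ℝ≥0 → ℝ≥0) (f : ℂ → ℂ) (τ : ℝ) : Prop :=
  ∃ w : ℂ, HasNontangentialValue f τ w ∧ ∃ C : ℝ≥0, 0 < C ∧
    (∀ D : ℝ≥0, 0 < D → supDist f w (horoRegion γ τ C D) < ∞) ∧
    Tendsto (fun D : ℝ≥0 => supDist f w (horoRegion γ τ C D)) atTop (𝓝 0)

end Horocyclic

end

namespace Horocyclic

/-! Near `τ` a Pick function is the Cauchy integral of its Nevanlinna measure `μ` up to an error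
with a limit at `τ`. Precisely, `(1 - (z - τ)²) f z` minus `(1/π) ∫ bump τ t / (t - z) dμ` is
Lipschitz near `τ` (`IsPick.exists_tendsto_sub_integral`). This comes from Cauchy's formula on a
rectangle for the shifts `f (· + iε)`, with `ε → 0`.

Regularity and `γ = O(t²)` make `1 / |t - τ|` integrable near `τ` and exclude an atom at `τ`. So the
Cauchy integral makes sense at `τ`, and its increment has kernel `(z - τ) / ((t - τ)(t - z))`. Where
`|t - z| ≥ κ|z - τ|`, dominated convergence makes the contribution vanish. For the remaining `t` an
integrable majorant must be supplied (`IsPick.exists_norm_sub_le`). In a Stolz region there are no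
such `t` if `κ` is the aperture. In the horocyclic region `|t - z| ≥ Im z ≥ D γ(C|t - τ|)` and `|t -
τ|` is comparable to `|z - τ|`, so the majorant is `(2/D) / γ(C|t - τ|)`, whose integral is
`O(1/D)`.

For the converse, place poles of mass `2⁻ⁿ γ(C tₙ)` at `τ + tₙ`, where `tₙ → 0` and `λ(tₙ)` is far
below this mass. Regularity becomes the geometric series, while just above the `n`-th pole, still
inside the `λ`-region, the imaginary part is at least `n + 1`. -/

/-! ### Regions in coordinates, and growth of Pick functions. -/

lemma infDist_frontier_upperHalfPlaneSet {z : ℂ} (hz : 0 < z.im) :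
    Metric.infDist z (frontier upperHalfPlaneSet) = z.im := by
  have hF : frontier upperHalfPlaneSet = {w : ℂ | w.im = 0} := Complex.frontier_setOfPred_lt_im 0
  have hne : (frontier upperHalfPlaneSet).Nonempty := by rw [hF]; exact ⟨0, by simp⟩
  apply le_antisymm
  · have hm : (z.re : ℂ) ∈ frontier upperHalfPlaneSet := by rw [hF]; simp
    refine (Metric.infDist_le_dist_of_mem hm).trans ?_
    have : z - z.re = z.im * Complex.I := by apply Complex.ext <;> simp
    rw [dist_eq_norm, this]
    simp [abs_of_pos hz]
  · refine (Metric.le_infDist hne).2 fun w hw => ?_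
    rw [hF] at hw
    have h := Complex.abs_im_le_norm (z - w)
    rw [Complex.sub_im, show w.im = 0 from hw, sub_zero, abs_of_pos hz] at h
    rwa [dist_eq_norm]

lemma mem_stolzRegion_iff {z : ℂ} {τ M : ℝ} :
    z ∈ stolzRegion upperHalfPlaneSet τ M ↔ 0 < z.im ∧ M * ‖z - τ‖ ≤ z.im := by
  constructor
  · rintro ⟨h1, h2⟩
    rw [infDist_frontier_upperHalfPlaneSet h1, dist_eq_norm] at h2
    exact ⟨h1, h2⟩
  · rintro ⟨h1, h2⟩
    refine ⟨h1, ?_⟩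
    rw [infDist_frontier_upperHalfPlaneSet h1, dist_eq_norm]
    exact h2

lemma mem_lamStolzRegion_iff {z : ℂ} {τ : ℝ} {lam : ℝ≥0 → ℝ≥0} :
    z ∈ lamStolzRegion upperHalfPlaneSet τ lam ↔
      0 < z.im ∧ ∃ c : ℝ≥0, 0 < c ∧ (lam c : ℝ) ≤ z.im ∧ |z.re - τ| ≤ c := by
  have key : ∀ h : 0 < z.im,
      Real.sqrt (dist z τ ^ 2 - Metric.infDist z (frontier upperHalfPlaneSet) ^ 2)
        = |z.re - τ| := by
    intro h
    rw [infDist_frontier_upperHalfPlaneSet h, dist_eq_norm, Complex.sq_norm, Complex.normSq_apply,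
      ← Real.sqrt_sq_eq_abs]
    congr 1
    simp
    ring
  constructor
  · rintro ⟨h1, c, hc, h2, h3⟩
    have h1' : 0 < z.im := h1
    rw [infDist_frontier_upperHalfPlaneSet h1'] at h2
    rw [key h1'] at h3
    exact ⟨h1, c, hc, h2, h3⟩
  · rintro ⟨h1, c, hc, h2, h3⟩
    refine ⟨h1, c, hc, ?_, ?_⟩
    · rwa [infDist_frontier_upperHalfPlaneSet h1]
    · rwa [key h1]

lemma IsPick.im_nonneg {f : ℂ → ℂ} (hf : IsPick f) {z : ℂ} (hz : 0 < z.im) : 0 ≤ (f z).im := by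
  have h := hf.mapsTo (show z ∈ upperHalfPlaneSet from hz)
  rw [show closure upperHalfPlaneSet = {w : ℂ | 0 ≤ w.im} from Complex.closure_setOfPred_lt_im 0]
    at h
  exact h

/-- A Pick function grows at most like the reciprocal of the distance to the boundary. -/
lemma IsPick.exists_norm_le_div_im {f : ℂ → ℂ} (hf : IsPick f) (τ : ℝ) :
    ∃ K : ℝ, 0 < K ∧ ∀ z : ℂ, |z.re - τ| ≤ 1 → 0 < z.im → z.im ≤ 2 → ‖f z‖ ≤ K / z.im := by
  obtain ⟨B, hB⟩ : ∃ B : ℝ, ∀ x ∈ Icc (τ - 1) (τ + 1), ‖f (x + 3 * Complex.I)‖ ≤ B := by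
    apply isCompact_Icc.exists_bound_of_continuousOn
    refine hf.analytic.continuousOn.comp (by fun_prop) fun x _ => ?_
    simp [upperHalfPlaneSet]
  have hB0 : 0 ≤ B := (norm_nonneg _).trans (hB τ ⟨by linarith, by linarith⟩)
  refine ⟨6 + 6 * B, by linarith, fun z hz1 hz2 hz3 => ?_⟩
  set c : ℂ := z.re + 3 * Complex.I with hc
  have hcB : ‖f c‖ ≤ B := hB _ ⟨by linarith [(abs_le.1 hz1).1], by linarith [(abs_le.1 hz1).2]⟩
  have him : ∀ w ∈ Metric.ball (0 : ℂ) 3, 0 < (c + w).im := fun w hw => by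
    have h1 := Complex.abs_im_le_norm w
    have h2 := mem_ball_zero_iff.1 hw
    have h3 := neg_abs_le w.im
    simp [hc]
    linarith
  have hzc : z - c = ((z.im - 3 : ℝ) : ℂ) * Complex.I := by
    apply Complex.ext <;> simp [hc]
  have hn : ‖z - c‖ = 3 - z.im := by
    rw [hzc, norm_mul, Complex.norm_I, mul_one, Complex.norm_real, Real.norm_eq_abs,
      abs_of_neg (by linarith)]
    ring
  -- `i f` has real part `-Im f ≤ 0 < 1` on the disc of radius 3 about `c`, which touches the real
  -- line. Since `‖z - c‖ = 3 - Im z`, the denominator `R - r` is exactly `Im z`.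
  have key := Complex.borelCaratheodory (f := fun w => Complex.I * f (c + w)) (M := 1) (R := 3)
    (z := z - c) one_pos
    (by
      refine DifferentiableOn.const_mul ?_ _
      exact hf.analytic.comp (by fun_prop) fun w hw => him w hw)
    (fun w hw => by
      have := hf.im_nonneg (him w hw)
      simp
      linarith) (by norm_num)
    (by rw [mem_ball_zero_iff, hn]; linarith)
  simp only [add_sub_cancel, norm_mul, Complex.norm_I, one_mul, add_zero, hn] at key
  refine key.trans ?_
  rw [← add_div, show (3 : ℝ) - (3 - z.im) = z.im by ring]
  refine div_le_div_of_nonneg_right ?_ hz2.le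
  nlinarith [norm_nonneg (f c)]

/-! ### Cauchy's formula on a rectangle. -/

section Rectangle

open Complex (log slitPlane)

lemma integral_inv_eq_log_sub_log {g : ℝ → ℂ} {q : ℂ} (a b : ℝ)
    (hg : ∀ t, HasDerivAt g q t) (h : ∀ t ∈ uIcc a b, g t ∈ slitPlane) :
    q * ∫ t in a..b, (g t)⁻¹ = log (g b) - log (g a) := by
  rw [← intervalIntegral.integral_const_mul]
  refine intervalIntegral.integral_eq_sub_of_hasDerivAt
    (f := fun t : ℝ => log (g t)) (fun t ht => ?_) ?_
  · simpa [div_eq_mul_inv] using (hg t).clog_real (h t ht)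
  · apply ContinuousOn.intervalIntegrable
    refine ContinuousOn.mul continuousOn_const (ContinuousOn.inv₀ ?_ fun t ht => ?_)
    · exact fun t _ => (hg t).continuousAt.continuousWithinAt
    · exact Complex.slitPlane_ne_zero (h t ht)

variable {a b c d : ℝ} {z : ℂ}

/-- The principal logarithm is a primitive on every side but the left one, which crosses the cut.
There `log (-(w - z))` is used, and the corrections `±πi` at its two corners add up to `2πi`. -/
lemma rect_integral_inv_sub (ha : a < z.re) (hb : z.re < b) (hc : c < z.im) (hd : z.im < d) :
    (∫ x : ℝ in a..b, (x + c * Complex.I - z)⁻¹) - (∫ x : ℝ in a..b, (x + d * Complex.I - z)⁻¹) +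
      Complex.I * (∫ y : ℝ in c..d, (b + y * Complex.I - z)⁻¹) -
      Complex.I * (∫ y : ℝ in c..d, (a + y * Complex.I - z)⁻¹) = 2 * Real.pi * Complex.I := by
  have hor : ∀ (e : ℝ) (t : ℝ), HasDerivAt (fun t : ℝ => t + e * Complex.I - z) 1 t := fun e t =>
    ((hasDerivAt_id t).ofReal_comp.add_const (e * Complex.I)).sub_const z
  have ver : ∀ (e : ℝ) (t : ℝ), HasDerivAt (fun t : ℝ => e + t * Complex.I - z) Complex.I t :=
    fun e t => by
      simpa using (((hasDerivAt_id t).ofReal_comp.mul_const Complex.I).const_add (e : ℂ)).sub_const z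
  have h1 := integral_inv_eq_log_sub_log a b (hor c) (fun t _ => by right; simp; linarith)
  have h2 := integral_inv_eq_log_sub_log a b (hor d) (fun t _ => by right; simp; linarith)
  have h3 := integral_inv_eq_log_sub_log c d (ver b) (fun t _ => by left; simp; linarith)
  have h4 := integral_inv_eq_log_sub_log c d (fun t => (ver a t).neg)
    (fun t _ => by left; simp; linarith)
  simp only [Pi.neg_apply, inv_neg, intervalIntegral.integral_neg] at h4
  have hlog1 : log (-(a + c * Complex.I - z)) = log (a + c * Complex.I - z) + Real.pi * Complex.I := by
    have him : (a + c * Complex.I - z).im < 0 := by simp; linarith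
    rw [log, log, norm_neg, Complex.arg_neg_eq_arg_add_pi_of_im_neg him]
    push_cast
    ring
  have hlog2 : log (-(a + d * Complex.I - z)) = log (a + d * Complex.I - z) - Real.pi * Complex.I := by
    have him : 0 < (a + d * Complex.I - z).im := by simp; linarith
    rw [log, log, norm_neg, Complex.arg_neg_eq_arg_sub_pi_of_im_pos him]
    push_cast
    ring
  rw [hlog1, hlog2] at h4
  linear_combination h1 - h2 + h3 - h4

lemma integral_dslope_comp {F : ℂ → ℂ} {s : Set ℂ} (hF : ContinuousOn F s) {g : ℝ → ℂ}
    (hg : Continuous g) {p q : ℝ} (hs : ∀ t ∈ uIcc p q, g t ∈ s) (hz : ∀ t ∈ uIcc p q, g t ≠ z) :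
    ∫ t in p..q, dslope F z (g t) =
      (∫ t in p..q, F (g t) / (g t - z)) - F z * ∫ t in p..q, (g t - z)⁻¹ := by
  have h0 : ∀ t ∈ uIcc p q, g t - z ≠ 0 := fun t ht => sub_ne_zero.2 (hz t ht)
  have hgc : ContinuousOn g (uIcc p q) := hg.continuousOn
  have hinv : ContinuousOn (fun t => (g t - z)⁻¹) (uIcc p q) := (hgc.sub continuousOn_const).inv₀ h0
  rw [← intervalIntegral.integral_const_mul, ← intervalIntegral.integral_sub]
  · refine intervalIntegral.integral_congr fun t ht => ?_
    simp only [dslope_of_ne _ (hz t ht), slope_def_field]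
    ring
  · exact ((hF.comp hgc hs).div (hgc.sub continuousOn_const) h0).intervalIntegrable
  · exact (continuousOn_const.mul hinv).intervalIntegrable

/-- **Cauchy's integral formula** on a rectangle. -/
lemma rect_integral_div_sub {F : ℂ → ℂ} (hF : DifferentiableOn ℂ F (uIcc a b ×ℂ uIcc c d))
    (ha : a < z.re) (hb : z.re < b) (hc : c < z.im) (hd : z.im < d) :
    (∫ x : ℝ in a..b, F (x + c * Complex.I) / (x + c * Complex.I - z)) -
      (∫ x : ℝ in a..b, F (x + d * Complex.I) / (x + d * Complex.I - z)) +
      Complex.I * (∫ y : ℝ in c..d, F (b + y * Complex.I) / (b + y * Complex.I - z)) -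
      Complex.I * (∫ y : ℝ in c..d, F (a + y * Complex.I) / (a + y * Complex.I - z)) =
      2 * Real.pi * Complex.I * F z := by
  have hab : a ≤ b := by linarith
  have hcd : c ≤ d := by linarith
  have hnhds : uIcc a b ×ℂ uIcc c d ∈ 𝓝 z := by
    rw [uIcc_of_le hab, uIcc_of_le hcd]
    refine mem_of_superset ((isOpen_Ioo.reProdIm isOpen_Ioo).mem_nhds ⟨⟨ha, hb⟩, ⟨hc, hd⟩⟩) ?_
    exact inter_subset_inter (preimage_mono Ioo_subset_Icc_self) (preimage_mono Ioo_subset_Icc_self)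
  -- The singularity of the difference quotient at `z` is removable, so its boundary integral
  -- vanishes; what is left is `F z` times the winding integral.
  have key := Complex.integral_boundary_rect_eq_zero_of_differentiableOn (dslope F z) ⟨a, c⟩ ⟨b, d⟩
    ((Complex.differentiableOn_dslope hnhds).2 hF)
  simp only [smul_eq_mul] at key
  have hFc := hF.continuousOn
  rw [integral_dslope_comp hFc (by fun_prop), integral_dslope_comp hFc (by fun_prop),
    integral_dslope_comp hFc (by fun_prop), integral_dslope_comp hFc (by fun_prop)] at key
  · linear_combination key + F z * rect_integral_inv_sub ha hb hc hd
  · exact fun t ht => by simpa [Complex.mem_reProdIm] using ht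
  · exact fun t _ h => by have := congrArg Complex.re h; simp at this; linarith
  · exact fun t ht => by simpa [Complex.mem_reProdIm] using ht
  · exact fun t _ h => by have := congrArg Complex.re h; simp at this; linarith
  · exact fun t ht => by simpa [Complex.mem_reProdIm] using ht
  · exact fun t _ h => by have := congrArg Complex.im h; simp at this; linarith
  · exact fun t ht => by simpa [Complex.mem_reProdIm] using ht
  · exact fun t _ h => by have := congrArg Complex.im h; simp at this; linarith

/-- The pole lies below the rectangle. This serves for the conjugate of an interior point when the
bottom side is on the real line. -/
lemma rect_integral_div_sub_of_im_lt {F : ℂ → ℂ}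
    (hF : DifferentiableOn ℂ F (uIcc a b ×ℂ uIcc c d)) (hcd : c ≤ d) (hz : z.im < c) :
    (∫ x : ℝ in a..b, F (x + c * Complex.I) / (x + c * Complex.I - z)) -
      (∫ x : ℝ in a..b, F (x + d * Complex.I) / (x + d * Complex.I - z)) +
      Complex.I * (∫ y : ℝ in c..d, F (b + y * Complex.I) / (b + y * Complex.I - z)) -
      Complex.I * (∫ y : ℝ in c..d, F (a + y * Complex.I) / (a + y * Complex.I - z)) = 0 := by
  refine Complex.integral_boundary_rect_eq_zero_of_differentiableOn
    (fun w => F w / (w - z)) ⟨a, c⟩ ⟨b, d⟩ ?_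
  refine hF.div (differentiableOn_id.sub_const z) fun w hw => sub_ne_zero.2 ?_
  rintro rfl
  have := hw.2
  simp only [uIcc_of_le hcd] at this
  exact absurd this.1 (not_le.2 hz)

end Rectangle

/-! ### The local Cauchy integral of the imaginary part. -/

/-- The parabolic bump `max (1 - (t - τ)²) 0`. -/
noncomputable def bump (τ t : ℝ) : ℝ := max (1 - (t - τ) ^ 2) 0

lemma continuous_bump (τ : ℝ) : Continuous (bump τ) := by unfold bump; fun_prop

lemma bump_nonneg (τ t : ℝ) : 0 ≤ bump τ t := le_max_right _ _

lemma bump_le_one (τ t : ℝ) : bump τ t ≤ 1 := max_le (by nlinarith [sq_nonneg (t - τ)]) zero_le_one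

lemma bump_eq_zero {τ t : ℝ} (h : 1 ≤ |t - τ|) : bump τ t = 0 := by
  have := one_le_sq_iff_one_le_abs (t - τ) |>.2 h
  exact max_eq_right (by linarith)

lemma bump_eq {τ t : ℝ} (h : |t - τ| ≤ 1) : bump τ t = 1 - (t - τ) ^ 2 := by
  have := sq_le_one_iff_abs_le_one (t - τ) |>.2 h
  exact max_eq_left (by linarith)

lemma hasCompactSupport_bump (τ : ℝ) : HasCompactSupport (bump τ) := by
  refine HasCompactSupport.intro (isCompact_Icc (a := τ - 1) (b := τ + 1)) fun t ht => ?_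
  refine bump_eq_zero ?_
  by_contra! h
  have := abs_lt.1 h
  exact ht ⟨by linarith, by linarith⟩

/-- The two kernels differ by `(z - z') / ((g t - z)(g t - z'))`, and each factor below is at least
`1/2` in norm. -/
lemma norm_integral_div_sub_sub_le {F : ℂ → ℂ} {g : ℝ → ℂ} {p q M : ℝ} {z z' : ℂ}
    (hg : Continuous g) (hF : ContinuousOn (fun t => F (g t)) (uIcc p q))
    (hM : ∀ t ∈ uIcc p q, ‖F (g t)‖ ≤ M)
    (hz : ∀ t ∈ uIcc p q, 1 / 2 ≤ ‖g t - z‖) (hz' : ∀ t ∈ uIcc p q, 1 / 2 ≤ ‖g t - z'‖) :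
    ‖(∫ t in p..q, F (g t) / (g t - z)) - ∫ t in p..q, F (g t) / (g t - z')‖ ≤
      4 * M * ‖z - z'‖ * |q - p| := by
  have h0 : ∀ t ∈ uIcc p q, g t - z ≠ 0 := fun t ht h => by
    have := hz t ht
    rw [h, norm_zero] at this
    norm_num at this
  have h0' : ∀ t ∈ uIcc p q, g t - z' ≠ 0 := fun t ht h => by
    have := hz' t ht
    rw [h, norm_zero] at this
    norm_num at this
  rw [← intervalIntegral.integral_sub]
  · refine intervalIntegral.norm_integral_le_of_norm_le_const fun t ht => ?_
    have ht := uIoc_subset_uIcc ht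
    have e : F (g t) / (g t - z) - F (g t) / (g t - z') =
        F (g t) * (z - z') / ((g t - z) * (g t - z')) := by
      have := h0 t ht
      have := h0' t ht
      field_simp
      ring
    have hden : 1 / 4 ≤ ‖g t - z‖ * ‖g t - z'‖ := by nlinarith [hz t ht, hz' t ht]
    rw [e, norm_div, norm_mul, norm_mul, div_le_iff₀ (by linarith)]
    have h1 : ‖F (g t)‖ * ‖z - z'‖ ≤ M * ‖z - z'‖ :=
      mul_le_mul_of_nonneg_right (hM t ht) (norm_nonneg _)
    have h2 : 0 ≤ M * ‖z - z'‖ := le_trans (by positivity) h1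
    nlinarith
  · exact (hF.div (hg.continuousOn.sub continuousOn_const) h0).intervalIntegrable
  · exact (hF.div (hg.continuousOn.sub continuousOn_const) h0').intervalIntegrable

/-- The contribution of the top and the vertical sides of `[τ - 1, τ + 1] × [0, 1]` to the Cauchy
integral of `F`. -/
noncomputable def sideIntegral (τ : ℝ) (F : ℂ → ℂ) (z : ℂ) : ℂ :=
  -(∫ x : ℝ in (τ - 1)..(τ + 1), F (x + (1 : ℝ) * Complex.I) / (x + (1 : ℝ) * Complex.I - z)) +
    Complex.I * (∫ y : ℝ in (0 : ℝ)..1, F ((τ + 1 : ℝ) + y * Complex.I) /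
      ((τ + 1 : ℝ) + y * Complex.I - z)) -
    Complex.I * (∫ y : ℝ in (0 : ℝ)..1, F ((τ - 1 : ℝ) + y * Complex.I) /
      ((τ - 1 : ℝ) + y * Complex.I - z))

/-- The half-size disc about `τ` keeps distance `1/2` from the three sides, whose total length is 4;
hence `4 M · 4`. -/
lemma norm_sideIntegral_sub_le {τ M : ℝ} {F : ℂ → ℂ} {z z' : ℂ}
    (hF : ContinuousOn F (uIcc (τ - 1) (τ + 1) ×ℂ uIcc 0 1))
    (hM1 : ∀ x : ℝ, |x - τ| ≤ 1 → ‖F (x + (1 : ℝ) * Complex.I)‖ ≤ M)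
    (hM2 : ∀ y ∈ Icc (0 : ℝ) 1, ‖F ((τ + 1 : ℝ) + y * Complex.I)‖ ≤ M)
    (hM3 : ∀ y ∈ Icc (0 : ℝ) 1, ‖F ((τ - 1 : ℝ) + y * Complex.I)‖ ≤ M)
    (hz : ‖z - τ‖ ≤ 1 / 2) (hz' : ‖z' - τ‖ ≤ 1 / 2) :
    ‖sideIntegral τ F z - sideIntegral τ F z'‖ ≤ 16 * M * ‖z - z'‖ := by
  have top : ∀ w : ℂ, ‖w - τ‖ ≤ 1 / 2 → ∀ x : ℝ, 1 / 2 ≤ ‖x + (1 : ℝ) * Complex.I - w‖ := by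
    intro w hw x
    refine le_trans ?_ (Complex.abs_im_le_norm _)
    have h2 := (Complex.abs_im_le_norm (w - τ)).trans hw
    simp at h2 ⊢
    have := le_abs_self (1 - w.im)
    have := (abs_le.1 h2).2
    linarith
  have rgt : ∀ w : ℂ, ‖w - τ‖ ≤ 1 / 2 → ∀ y : ℝ,
      1 / 2 ≤ ‖(τ + 1 : ℝ) + y * Complex.I - w‖ := by
    intro w hw x
    refine le_trans ?_ (Complex.abs_re_le_norm _)
    have h2 := (Complex.abs_re_le_norm (w - τ)).trans hw
    simp at h2 ⊢
    have := le_abs_self (τ + 1 - w.re)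
    have := (abs_le.1 h2).2
    linarith
  have lft : ∀ w : ℂ, ‖w - τ‖ ≤ 1 / 2 → ∀ y : ℝ,
      1 / 2 ≤ ‖(τ - 1 : ℝ) + y * Complex.I - w‖ := by
    intro w hw x
    refine le_trans ?_ (Complex.abs_re_le_norm _)
    have h2 := (Complex.abs_re_le_norm (w - τ)).trans hw
    simp at h2 ⊢
    have := neg_le_abs (τ - 1 - w.re)
    have := (abs_le.1 h2).1
    linarith
  have hle : τ - 1 ≤ τ + 1 := by linarith
  have b1 := norm_integral_div_sub_sub_le (F := F) (M := M) (p := τ - 1) (q := τ + 1)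
    (g := fun x : ℝ => x + (1 : ℝ) * Complex.I) (by fun_prop)
    (hF.comp (by fun_prop) fun t ht => by simpa [Complex.mem_reProdIm] using ht)
    (fun t ht => hM1 t (by
      rw [uIcc_of_le hle] at ht
      exact abs_le.2 ⟨by linarith [ht.1], by linarith [ht.2]⟩))
    (fun t _ => top z hz t) (fun t _ => top z' hz' t)
  have b2 := norm_integral_div_sub_sub_le (F := F) (M := M) (p := 0) (q := 1)
    (g := fun y : ℝ => (τ + 1 : ℝ) + y * Complex.I) (by fun_prop)
    (hF.comp (by fun_prop) fun t ht => by simpa [Complex.mem_reProdIm] using ht)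
    (fun t ht => hM2 t (by rwa [uIcc_of_le zero_le_one] at ht))
    (fun t _ => rgt z hz t) (fun t _ => rgt z' hz' t)
  have b3 := norm_integral_div_sub_sub_le (F := F) (M := M) (p := 0) (q := 1)
    (g := fun y : ℝ => (τ - 1 : ℝ) + y * Complex.I) (by fun_prop)
    (hF.comp (by fun_prop) fun t ht => by simpa [Complex.mem_reProdIm] using ht)
    (fun t ht => hM3 t (by rwa [uIcc_of_le zero_le_one] at ht))
    (fun t _ => lft z hz t) (fun t _ => lft z' hz' t)
  rw [show τ + 1 - (τ - 1) = 2 by ring, abs_two] at b1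
  rw [sub_zero, abs_one] at b2 b3
  unfold sideIntegral
  set A := ∫ x : ℝ in (τ - 1)..(τ + 1), F (x + (1 : ℝ) * Complex.I) / (x + (1 : ℝ) * Complex.I - z)
  set A' := ∫ x : ℝ in (τ - 1)..(τ + 1),
    F (x + (1 : ℝ) * Complex.I) / (x + (1 : ℝ) * Complex.I - z')
  set B := ∫ y : ℝ in (0 : ℝ)..1, F ((τ + 1 : ℝ) + y * Complex.I) /
      ((τ + 1 : ℝ) + y * Complex.I - z)
  set B' := ∫ y : ℝ in (0 : ℝ)..1, F ((τ + 1 : ℝ) + y * Complex.I) /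
      ((τ + 1 : ℝ) + y * Complex.I - z')
  set C := ∫ y : ℝ in (0 : ℝ)..1, F ((τ - 1 : ℝ) + y * Complex.I) /
      ((τ - 1 : ℝ) + y * Complex.I - z)
  set C' := ∫ y : ℝ in (0 : ℝ)..1, F ((τ - 1 : ℝ) + y * Complex.I) /
      ((τ - 1 : ℝ) + y * Complex.I - z')
  calc ‖-A + Complex.I * B - Complex.I * C - (-A' + Complex.I * B' - Complex.I * C')‖
      = ‖-(A - A') + Complex.I * (B - B') - Complex.I * (C - C')‖ := by congr 1; ring
    _ ≤ ‖-(A - A')‖ + ‖Complex.I * (B - B')‖ + ‖Complex.I * (C - C')‖ :=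
      (norm_sub_le _ _).trans (add_le_add_left (norm_add_le _ _) _)
    _ = ‖A - A'‖ + ‖B - B'‖ + ‖C - C'‖ := by
      simp only [norm_neg, norm_mul, Complex.norm_I, one_mul]
    _ ≤ 16 * M * ‖z - z'‖ := by linarith

/-- A local Cauchy–Schwarz type formula: a function holomorphic on `[τ - 1, τ + 1] × [0, 1]` is
recovered from its imaginary part on the bottom side and a contribution of the other sides. -/
lemma sub_integral_im_eq_sideIntegral {τ : ℝ} {F : ℂ → ℂ} {z : ℂ}
    (hF : DifferentiableOn ℂ F (uIcc (τ - 1) (τ + 1) ×ℂ uIcc 0 1))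
    (hz : ‖z - τ‖ ≤ 1 / 2) (hz0 : 0 < z.im) :
    F z - (1 / Real.pi : ℝ) * ∫ t : ℝ in (τ - 1)..(τ + 1), ((F t).im : ℂ) / (t - z) =
      (2 * Real.pi * Complex.I)⁻¹ * (sideIntegral τ F z -
        starRingEnd ℂ (sideIntegral τ F (starRingEnd ℂ z))) := by
  have hre := (Complex.abs_re_le_norm (z - τ)).trans hz
  have him := (Complex.abs_im_le_norm (z - τ)).trans hz
  simp only [Complex.sub_re, Complex.ofReal_re, Complex.sub_im, Complex.ofReal_im, sub_zero]
    at hre him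
  have hre := abs_le.1 hre
  have him := abs_le.1 him
  have h1 := rect_integral_div_sub hF (z := z) (by linarith) (by linarith) hz0 (by linarith)
  have h2 := rect_integral_div_sub_of_im_lt hF (z := starRingEnd ℂ z) zero_le_one
    (by simpa using hz0)
  have hcont : ContinuousOn (fun t : ℝ => F t) (uIcc (τ - 1) (τ + 1)) :=
    hF.continuousOn.comp (by fun_prop) fun t ht => by simpa [Complex.mem_reProdIm] using ht
  have hden : ∀ t : ℝ, (t : ℂ) - z ≠ 0 := fun t h => by
    have := congrArg Complex.im h
    simp at this
    linarith
  -- Conjugating the formula at `conj z` restores the kernel `1 / (t - z)`. Subtracting it from the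
  -- formula at `z` leaves `F - conj F = 2i Im F` on the bottom side.
  have h3 : starRingEnd ℂ (∫ t : ℝ in (τ - 1)..(τ + 1), F t / (t - starRingEnd ℂ z)) =
      ∫ t : ℝ in (τ - 1)..(τ + 1), starRingEnd ℂ (F t) / (t - z) := by
    rw [intervalIntegral, intervalIntegral, map_sub, ← integral_conj, ← integral_conj]
    simp
  have h4 : (∫ t : ℝ in (τ - 1)..(τ + 1), F t / (t - z)) -
      ∫ t : ℝ in (τ - 1)..(τ + 1), starRingEnd ℂ (F t) / (t - z) =
      2 * Complex.I * ∫ t : ℝ in (τ - 1)..(τ + 1), ((F t).im : ℂ) / (t - z) := by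
    rw [← intervalIntegral.integral_const_mul, ← intervalIntegral.integral_sub]
    · refine intervalIntegral.integral_congr fun t _ => ?_
      have := Complex.sub_conj (F t)
      rw [← sub_div, this]
      push_cast
      ring
    · exact (hcont.div (by fun_prop) fun t _ => hden t).intervalIntegrable
    · exact (ContinuousOn.div (Complex.continuous_conj.comp_continuousOn hcont) (by fun_prop)
        fun t _ => hden t).intervalIntegrable
  simp only [Complex.ofReal_zero, zero_mul, add_zero] at h1 h2
  have h2' := congrArg (starRingEnd ℂ)
    (show (∫ t : ℝ in (τ - 1)..(τ + 1), F t / (t - starRingEnd ℂ z)) +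
      sideIntegral τ F (starRingEnd ℂ z) = 0 by rw [← h2]; unfold sideIntegral; ring)
  rw [map_add, h3, map_zero] at h2'
  have h1' : (∫ t : ℝ in (τ - 1)..(τ + 1), F t / (t - z)) + sideIntegral τ F z =
      2 * Real.pi * Complex.I * F z := by rw [← h1]; unfold sideIntegral; ring
  have hpi : (Real.pi : ℂ) ≠ 0 := by exact_mod_cast Real.pi_ne_zero
  push_cast
  field_simp
  linear_combination h2' - h1' + h4

section

lemma IsPick.continuous_horizontal {f : ℂ → ℂ} (hf : IsPick f) {y : ℝ} (hy : 0 < y) :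
    Continuous fun x : ℝ => f (x + y * Complex.I) := by
  rw [← continuousOn_univ]
  exact hf.analytic.continuousOn.comp (by fun_prop) fun x _ => by simpa [upperHalfPlaneSet] using hy

lemma IsNevanlinnaMeasure.tendsto_complex {f : ℂ → ℂ} {μ : Measure ℝ} (hf : IsPick f)
    (hμ : IsNevanlinnaMeasure f μ) {φ : ℝ → ℂ} (hφ : Continuous φ) (hs : HasCompactSupport φ) :
    Tendsto (fun y : ℝ => ∫ x : ℝ, φ x * ((f (x + y * Complex.I)).im : ℂ)) (𝓝[>] 0)
      (𝓝 (∫ x, φ x ∂μ)) := by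
  have := hμ.locallyFinite
  have hre := hμ.tendsto (fun x => (φ x).re) (by fun_prop)
    (hs.comp_left (g := Complex.re) Complex.zero_re)
  have him := hμ.tendsto (fun x => (φ x).im) (by fun_prop)
    (hs.comp_left (g := Complex.im) Complex.zero_im)
  have hsplit : ∫ x, φ x ∂μ = ((∫ x, (φ x).re ∂μ : ℝ) : ℂ) +
      ((∫ x, (φ x).im ∂μ : ℝ) : ℂ) * Complex.I :=
    (integral_re_add_im (𝕜 := ℂ) (hφ.integrable_of_hasCompactSupport hs)).symm
  rw [hsplit]
  refine Tendsto.congr' ?_ (((Complex.continuous_ofReal.tendsto _).comp hre).add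
    (((Complex.continuous_ofReal.tendsto _).comp him).mul_const Complex.I))
  filter_upwards [self_mem_nhdsWithin] with y hy
  have hc := hf.continuous_horizontal hy
  have hint : Integrable fun x : ℝ => φ x * ((f (x + y * Complex.I)).im : ℂ) :=
    (hφ.mul (Complex.continuous_ofReal.comp (Complex.continuous_im.comp hc))).integrable_of_hasCompactSupport
      hs.mul_right
  rw [← integral_re_add_im (𝕜 := ℂ) hint]
  simp

variable {f : ℂ → ℂ} {τ K : ℝ}

/-- The difference of a shift of a Pick function, multiplied by `1 - (z - τ)²`, and the local Cauchy
integral of its imaginary part is Lipschitz near `τ`, uniformly in the shift. -/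
lemma IsPick.norm_sub_integral_sub_le (hf : IsPick f) {z z' : ℂ} {ε : ℝ}
    (hK : ∀ z : ℂ, |z.re - τ| ≤ 1 → 0 < z.im → z.im ≤ 2 → ‖f z‖ ≤ K / z.im)
    (hε : 0 < ε) (hε1 : ε ≤ 1)
    (hz : ‖z - τ‖ ≤ 1 / 2) (hz0 : 0 < z.im) (hz' : ‖z' - τ‖ ≤ 1 / 2) (hz0' : 0 < z'.im) :
    ‖((1 - (z - τ) ^ 2) * f (z + ε * Complex.I) - (1 / Real.pi : ℝ) *
        ∫ t : ℝ, bump τ t / (t - z) * ((f (t + ε * Complex.I)).im : ℂ)) -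
      ((1 - (z' - τ) ^ 2) * f (z' + ε * Complex.I) - (1 / Real.pi : ℝ) *
        ∫ t : ℝ, bump τ t / (t - z') * ((f (t + ε * Complex.I)).im : ℂ))‖ ≤
      48 * K * ‖z - z'‖ := by
  have hK0 : 0 ≤ K := by
    have := (norm_nonneg _).trans (hK (τ + Complex.I) (by simp) (by simp) (by simp))
    simpa using this
  -- The factor `1 - (w - τ)²` is real on the real line, where it agrees with `bump` on the segment.
  -- It vanishes at `τ ± 1` and is at most `3y` at height `y` on the vertical sides. This absorbs
  -- the growth `K / (y + ε)` of `f` there and makes the bounds uniform in `ε`.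
  set F : ℂ → ℂ := fun w => (1 - (w - τ) ^ 2) * f (w + ε * Complex.I) with hFdef
  have hF : DifferentiableOn ℂ F (uIcc (τ - 1) (τ + 1) ×ℂ uIcc 0 1) := by
    refine DifferentiableOn.mul (by fun_prop) (hf.analytic.comp (by fun_prop) fun w hw => ?_)
    have := hw.2
    rw [uIcc_of_le zero_le_one] at this
    have : 0 ≤ w.im := this.1
    simp [upperHalfPlaneSet]
    linarith
  have hfb : ∀ x y : ℝ, |x - τ| ≤ 1 → 0 ≤ y → y ≤ 1 →
      ‖f (x + y * Complex.I + ε * Complex.I)‖ ≤ K / (y + ε) := fun x y hx hy hy1 => by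
    have h := hK (x + y * Complex.I + ε * Complex.I) (by simpa using hx)
      (by simp; linarith) (by simp; linarith)
    simpa using h
  have hM1 : ∀ x : ℝ, |x - τ| ≤ 1 → ‖F (x + (1 : ℝ) * Complex.I)‖ ≤ 3 * K := fun x hx => by
    have h1 := hfb x 1 hx zero_le_one le_rfl
    have h2 : K / (1 + ε) ≤ K := div_le_self hK0 (by linarith)
    have h3 : ‖(x + (1 : ℝ) * Complex.I - τ : ℂ)‖ ^ 2 ≤ 2 := by
      rw [Complex.sq_norm, Complex.normSq_apply]
      have := (sq_le_one_iff_abs_le_one _).2 hx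
      simp
      nlinarith
    have h4 : ‖1 - (x + (1 : ℝ) * Complex.I - τ : ℂ) ^ 2‖ ≤ 3 := by
      refine (norm_sub_le _ _).trans ?_
      rw [norm_one, norm_pow]
      linarith
    rw [hFdef, norm_mul]
    exact mul_le_mul h4 (h1.trans h2) (norm_nonneg _) (by norm_num)
  have hver : ∀ σ : ℝ, σ ^ 2 = 1 → ∀ y ∈ Icc (0 : ℝ) 1,
      ‖F ((τ + σ : ℝ) + y * Complex.I)‖ ≤ 3 * K := fun σ hσ y hy => by
    have hσ1 : |σ| = 1 := by
      rcases sq_eq_one_iff.1 hσ with rfl | rfl <;> simp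
    have h1 := hfb (τ + σ) y (by simp [hσ1]) hy.1 hy.2
    have h4 : ‖1 - ((τ + σ : ℝ) + y * Complex.I - τ : ℂ) ^ 2‖ ≤ 3 * y := by
      have e : 1 - ((τ + σ : ℝ) + y * Complex.I - τ : ℂ) ^ 2 =
          y * (y - 2 * σ * Complex.I) := by
        have hσ' : (σ : ℂ) ^ 2 = 1 := by exact_mod_cast hσ
        push_cast
        linear_combination -hσ' - (y : ℂ) ^ 2 * Complex.I_sq
      rw [e, norm_mul, Complex.norm_real, Real.norm_eq_abs, abs_of_nonneg hy.1, mul_comm 3]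
      refine mul_le_mul_of_nonneg_left ((norm_sub_le _ _).trans ?_) hy.1
      simp only [norm_mul, Complex.norm_real, Real.norm_eq_abs, abs_of_nonneg hy.1, hσ1,
        Complex.norm_I, Complex.norm_ofNat]
      linarith [hy.2]
    rw [hFdef, norm_mul]
    refine (mul_le_mul h4 h1 (norm_nonneg _) (by linarith [hy.1])).trans ?_
    have hpos : 0 < y + ε := by linarith [hy.1]
    rw [← mul_div_assoc, div_le_iff₀ hpos]
    nlinarith [mul_nonneg hK0 hε.le]
  have hside : ∀ {w w' : ℂ}, ‖w - τ‖ ≤ 1 / 2 → ‖w' - τ‖ ≤ 1 / 2 →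
      ‖sideIntegral τ F w - sideIntegral τ F w'‖ ≤ 16 * (3 * K) * ‖w - w'‖ := fun hw hw' =>
    norm_sideIntegral_sub_le hF.continuousOn hM1 (hver 1 (by norm_num))
      (by simpa [sub_eq_add_neg] using hver (-1) (by norm_num)) hw hw'
  have hJ : ∀ w : ℂ, ∫ t : ℝ, bump τ t / (t - w) * ((f (t + ε * Complex.I)).im : ℂ) =
      ∫ t : ℝ in (τ - 1)..(τ + 1), ((F t).im : ℂ) / (t - w) := fun w => by
    have hle : τ - 1 ≤ τ + 1 := by linarith
    rw [intervalIntegral.integral_of_le hle, ← setIntegral_eq_integral_of_forall_compl_eq_zero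
      (s := Ioc (τ - 1) (τ + 1))]
    · refine setIntegral_congr_fun measurableSet_Ioc fun t ht => ?_
      have hF' : F t = ((1 - (t - τ) ^ 2 : ℝ) : ℂ) * f (t + ε * Complex.I) := by
        rw [hFdef]; push_cast; rfl
      rw [bump_eq (abs_le.2 ⟨by linarith [ht.1], by linarith [ht.2]⟩), hF', Complex.im_ofReal_mul]
      push_cast
      ring
    · intro t ht
      rw [bump_eq_zero]
      · simp
      · by_contra! h
        have := abs_lt.1 h
        exact ht ⟨by linarith, by linarith⟩
  have hconj : ∀ {w : ℂ}, ‖w - τ‖ ≤ 1 / 2 → ‖starRingEnd ℂ w - τ‖ ≤ 1 / 2 := fun {w} hw => by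
    rw [← Complex.norm_conj]
    simpa using hw
  have e1 := sub_integral_im_eq_sideIntegral hF hz hz0
  have e2 := sub_integral_im_eq_sideIntegral hF hz' hz0'
  rw [hJ z, hJ z']
  change ‖(F z - _) - (F z' - _)‖ ≤ _
  rw [e1, e2, ← mul_sub, norm_mul]
  have hpi : ‖(2 * Real.pi * Complex.I : ℂ)⁻¹‖ ≤ 1 / 2 := by
    rw [norm_inv]
    simp only [norm_mul, Complex.norm_I, Complex.norm_ofNat, Complex.norm_real, Real.norm_eq_abs,
      abs_of_pos Real.pi_pos, mul_one]
    rw [inv_le_comm₀ (by positivity) (by norm_num)]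
    linarith [Real.pi_gt_three]
  -- Each of the two side terms contributes `16 · 3K = 48K`.
  have hd : ‖sideIntegral τ F z - starRingEnd ℂ (sideIntegral τ F (starRingEnd ℂ z)) -
      (sideIntegral τ F z' - starRingEnd ℂ (sideIntegral τ F (starRingEnd ℂ z')))‖ ≤
      96 * K * ‖z - z'‖ := by
    have h1 := hside hz hz'
    have h2 := hside (hconj hz) (hconj hz')
    rw [← Complex.norm_conj, map_sub, ← map_sub (starRingEnd ℂ) z z', Complex.norm_conj (z - z')]
      at h2
    rw [sub_sub_sub_comm]
    refine (norm_sub_le _ _).trans ?_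
    linarith
  calc _ ≤ 1 / 2 * (96 * K * ‖z - z'‖) := mul_le_mul hpi hd (norm_nonneg _) (by norm_num)
    _ = 48 * K * ‖z - z'‖ := by ring

/-- Near `τ`, a Pick function is the Cauchy integral of its Nevanlinna measure up to a function with
a limit at `τ`. -/
theorem IsPick.exists_tendsto_sub_integral (hf : IsPick f) {μ : Measure ℝ}
    (hμ : IsNevanlinnaMeasure f μ) (τ : ℝ) :
    ∃ w : ℂ, Tendsto (fun z : ℂ => (1 - (z - τ) ^ 2) * f z -
      (1 / Real.pi : ℝ) * ∫ t : ℝ, (bump τ t / (t - z) : ℂ) ∂μ)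
      (𝓝[upperHalfPlaneSet] (τ : ℂ)) (𝓝 w) := by
  obtain ⟨K, hK0, hK⟩ := hf.exists_norm_le_div_im τ
  set G : ℂ → ℂ := fun z : ℂ => (1 - (z - τ) ^ 2) * f z -
      (1 / Real.pi : ℝ) * ∫ t : ℝ, (bump τ t / (t - z) : ℂ) ∂μ with hG
  have hlim : ∀ z : ℂ, 0 < z.im → Tendsto (fun ε : ℝ => (1 - (z - τ) ^ 2) * f (z + ε * Complex.I) -
      (1 / Real.pi : ℝ) * ∫ t : ℝ, bump τ t / (t - z) * ((f (t + ε * Complex.I)).im : ℂ))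
      (𝓝[>] 0) (𝓝 (G z)) := fun z hz => by
    refine Tendsto.sub (Tendsto.const_mul _ ?_) (Tendsto.const_mul _ ?_)
    · have h1 : ContinuousAt f z :=
        (hf.analytic.differentiableAt (isOpen_upperHalfPlaneSet.mem_nhds hz)).continuousAt
      have h2 : Tendsto (fun ε : ℝ => z + ε * Complex.I) (𝓝[>] 0) (𝓝 z) := by
        have : ContinuousAt (fun ε : ℝ => z + ε * Complex.I) 0 := by fun_prop
        have := this.tendsto
        simp only [Complex.ofReal_zero, zero_mul, add_zero] at this
        exact this.mono_left nhdsWithin_le_nhds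
      exact h1.tendsto.comp h2
    -- For fixed `z` off the real line, the kernel is itself an admissible test function.
    · refine hμ.tendsto_complex hf (φ := fun t : ℝ => (bump τ t / (t - z) : ℂ)) ?_ ?_
      · have := continuous_bump τ
        refine Continuous.div (by fun_prop) (by fun_prop) fun t h => ?_
        have := congrArg Complex.im h
        simp at this
        linarith
      · have : HasCompactSupport fun t => (bump τ t : ℂ) :=
          (hasCompactSupport_bump τ).comp_left Complex.ofReal_zero
        simp only [div_eq_mul_inv]
        exact this.mul_right
  have hlip : LipschitzOnWith (Real.toNNReal (48 * K)) G
      (upperHalfPlaneSet ∩ Metric.closedBall (τ : ℂ) (1 / 2)) := by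
    refine LipschitzOnWith.of_dist_le_mul fun z hz z' hz' => ?_
    rw [Real.coe_toNNReal _ (by positivity), dist_eq_norm, dist_eq_norm]
    refine le_of_tendsto ((hlim z hz.1).sub (hlim z' hz'.1)).norm ?_
    filter_upwards [Ioc_mem_nhdsGT (zero_lt_one' ℝ)] with ε hε
    exact hf.norm_sub_integral_sub_le hK hε.1 hε.2 (by simpa [dist_eq_norm] using hz.2) hz.1
      (by simpa [dist_eq_norm] using hz'.2) hz'.1
  -- A Lipschitz extension to all of `ℂ` supplies the limit as its value at `τ`.
  obtain ⟨g, hg, hEq⟩ := hlip.extend_finite_dimension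
  refine ⟨g τ, Tendsto.congr' ?_ (hg.continuous.continuousAt.tendsto.mono_left nhdsWithin_le_nhds)⟩
  filter_upwards [self_mem_nhdsWithin, mem_nhdsWithin_of_mem_nhds
    (Metric.closedBall_mem_nhds (τ : ℂ) (by norm_num : (0 : ℝ) < 1 / 2))] with z h1 h2
  exact (hEq ⟨h1, h2⟩).symm

end

/-! ### Near and far parts of the Cauchy kernel. -/

section

lemma ofReal_sub_ne_zero {z : ℂ} (hz : 0 < z.im) (t : ℝ) : (t : ℂ) - z ≠ 0 := fun h => by
  have := congrArg Complex.im h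
  simp at this
  linarith

lemma im_le_norm_ofReal_sub {z : ℂ} (t : ℝ) : z.im ≤ ‖(t : ℂ) - z‖ := by
  have := Complex.abs_im_le_norm ((t : ℂ) - z)
  simp only [Complex.sub_im, Complex.ofReal_im, zero_sub, abs_neg] at this
  exact (le_abs_self _).trans this

/-- The modulus of the difference of the integrands of the local Cauchy integral at `z` and at
`τ`, away from `z`. -/
noncomputable def farKernel (τ κ : ℝ) (z : ℂ) (t : ℝ) : ℝ :=
  if κ * ‖z - τ‖ ≤ ‖(t : ℂ) - z‖ then bump τ t * ‖z - τ‖ / (|t - τ| * ‖(t : ℂ) - z‖) else 0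

lemma farKernel_nonneg (τ κ : ℝ) (z : ℂ) (t : ℝ) : 0 ≤ farKernel τ κ z t := by
  have := bump_nonneg τ t
  unfold farKernel
  split_ifs <;> positivity

lemma measurable_farKernel (τ κ : ℝ) (z : ℂ) : Measurable (farKernel τ κ z) := by
  have := (continuous_bump τ).measurable
  refine Measurable.ite ?_ (by fun_prop) measurable_const
  exact measurableSet_le measurable_const (by fun_prop)

/-- On the far set `‖z - τ‖ / ‖t - z‖ ≤ κ⁻¹`, which gives a majorant independent of `z`. -/
lemma farKernel_le {τ κ : ℝ} (hκ : 0 < κ) (z : ℂ) (t : ℝ) :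
    farKernel τ κ z t ≤ κ⁻¹ * (bump τ t * |t - τ|⁻¹) := by
  have hb := bump_nonneg τ t
  have h0 : 0 ≤ κ⁻¹ * (bump τ t * |t - τ|⁻¹) := by positivity
  unfold farKernel
  split_ifs with h
  · rcases eq_or_lt_of_le (norm_nonneg ((t : ℂ) - z)) with h1 | h1
    · simpa [← h1] using h0
    · have h2 : ‖z - τ‖ / ‖(t : ℂ) - z‖ ≤ κ⁻¹ := by
        rw [div_le_iff₀ h1, ← div_eq_inv_mul, le_div_iff₀ hκ]
        linarith
      calc bump τ t * ‖z - τ‖ / (|t - τ| * ‖(t : ℂ) - z‖)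
          = ‖z - τ‖ / ‖(t : ℂ) - z‖ * (bump τ t * |t - τ|⁻¹) := by ring
        _ ≤ _ := mul_le_mul_of_nonneg_right h2 (by positivity)
  · exact h0

variable {μ : Measure ℝ} {τ κ : ℝ}

lemma tendsto_integral_farKernel (hκ : 0 < κ) (h0 : μ {τ} = 0)
    (hint : Integrable (fun t => bump τ t * |t - τ|⁻¹) μ) (s : Set ℂ) :
    Tendsto (fun z => ∫ t, farKernel τ κ z t ∂μ) (𝓝[s] (τ : ℂ)) (𝓝 0) := by
  rw [← integral_zero ℝ ℝ (μ := μ)]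
  refine tendsto_integral_filter_of_dominated_convergence
    (fun t => κ⁻¹ * (bump τ t * |t - τ|⁻¹))
    (Eventually.of_forall fun z => (measurable_farKernel τ κ z).aestronglyMeasurable)
    (Eventually.of_forall fun z => Eventually.of_forall fun t => ?_) (hint.const_mul _) ?_
  · rw [Real.norm_of_nonneg (farKernel_nonneg _ _ _ _)]
    exact farKernel_le hκ z t
  · have hne : ∀ᵐ t ∂μ, t ≠ τ := by
      rw [ae_iff]
      simpa using h0
    filter_upwards [hne] with t ht
    have ht' : (t : ℂ) - τ ≠ 0 := by
      rw [sub_ne_zero]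
      exact_mod_cast ht
    have hc : ContinuousAt (fun z : ℂ => bump τ t * ‖z - τ‖ / (|t - τ| * ‖(t : ℂ) - z‖)) τ :=
      ContinuousAt.div (by fun_prop) (by fun_prop)
        (mul_ne_zero (abs_ne_zero.2 (sub_ne_zero.2 ht)) (norm_ne_zero_iff.2 ht'))
    have hc' := hc.tendsto
    simp only [sub_self, norm_zero, mul_zero, zero_div] at hc'
    refine squeeze_zero (fun z => farKernel_nonneg _ _ _ _) (fun z => ?_)
      (hc'.mono_left nhdsWithin_le_nhds)
    unfold farKernel
    split_ifs
    · exact le_rfl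
    · have := bump_nonneg τ t
      positivity

/-- The integrands differ by `bump τ t (z - τ) / ((t - τ)(t - z))`. Only on the near set is the
majorant `B` needed, so its choice is left to the geometry of the approach region. -/
lemma norm_integral_sub_integral_le [IsLocallyFiniteMeasure μ] (hκ : 0 < κ) (h0 : μ {τ} = 0)
    (hint : Integrable (fun t => bump τ t * |t - τ|⁻¹) μ) {z : ℂ} (hz : 0 < z.im) {B : ℝ → ℝ}
    (hB : Integrable B μ) (hB0 : ∀ t, 0 ≤ B t)
    (hBz : ∀ t, t ≠ τ → ‖(t : ℂ) - z‖ < κ * ‖z - τ‖ →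
      bump τ t * ‖z - τ‖ / (|t - τ| * ‖(t : ℂ) - z‖) ≤ B t) :
    ‖(∫ t : ℝ, (bump τ t / (t - z) : ℂ) ∂μ) - ∫ t : ℝ, (bump τ t / (t - τ) : ℂ) ∂μ‖ ≤
      (∫ t, farKernel τ κ z t ∂μ) + ∫ t, B t ∂μ := by
  have hbc := continuous_bump τ
  have hfar : Integrable (farKernel τ κ z) μ := by
    refine (hint.const_mul κ⁻¹).mono' (measurable_farKernel τ κ z).aestronglyMeasurable
      (Eventually.of_forall fun t => ?_)
    rw [Real.norm_of_nonneg (farKernel_nonneg _ _ _ _)]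
    exact farKernel_le hκ z t
  have i1 : Integrable (fun t : ℝ => (bump τ t / (t - z) : ℂ)) μ := by
    refine Continuous.integrable_of_hasCompactSupport
      (Continuous.div (by fun_prop) (by fun_prop) (ofReal_sub_ne_zero hz)) ?_
    have : HasCompactSupport fun t => (bump τ t : ℂ) :=
      (hasCompactSupport_bump τ).comp_left Complex.ofReal_zero
    simp only [div_eq_mul_inv]
    exact this.mul_right
  have i2 : Integrable (fun t : ℝ => (bump τ t / (t - τ) : ℂ)) μ := by
    refine hint.mono' (Measurable.aestronglyMeasurable
      (by have := hbc.measurable; fun_prop)) (Eventually.of_forall fun t => ?_)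
    rw [norm_div, ← Complex.ofReal_sub, Complex.norm_real, Complex.norm_real,
      Real.norm_of_nonneg (bump_nonneg _ _), Real.norm_eq_abs, div_eq_mul_inv]
  rw [← integral_sub i1 i2, ← integral_add hfar hB]
  refine norm_integral_le_of_norm_le (hfar.add hB) ?_
  have hne : ∀ᵐ t ∂μ, t ≠ τ := by
    rw [ae_iff]
    simpa using h0
  filter_upwards [hne] with t ht
  have ht' : (t : ℂ) - τ ≠ 0 := by
    rw [sub_ne_zero]
    exact_mod_cast ht
  have htz := ofReal_sub_ne_zero hz t
  have e : (bump τ t / (t - z) - bump τ t / (t - τ) : ℂ) =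
      bump τ t * (z - τ) / (((t - τ : ℝ) : ℂ) * (t - z)) := by
    push_cast
    field_simp
    ring
  rw [e, norm_div, norm_mul, norm_mul, Complex.norm_real, Complex.norm_real, Real.norm_eq_abs,
    Real.norm_eq_abs, abs_of_nonneg (bump_nonneg τ t)]
  by_cases h : κ * ‖z - τ‖ ≤ ‖(t : ℂ) - z‖
  · rw [farKernel, if_pos h]
    exact le_add_of_nonneg_right (hB0 t)
  · exact (hBz t ht (not_le.1 h)).trans (le_add_of_nonneg_left (farKernel_nonneg _ _ _ _))

/-- The value `w` is fixed before `κ`, so that nontangential and horocyclic approach share one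
limit. The factor 2 undoes `1 - (z - τ)²`, which is at least `1/2` in norm here. -/
theorem IsPick.exists_norm_sub_le {f : ℂ → ℂ} (hf : IsPick f) (hμ : IsNevanlinnaMeasure f μ)
    (h0 : μ {τ} = 0) (hint : Integrable (fun t => bump τ t * |t - τ|⁻¹) μ) :
    ∃ w : ℂ, ∀ κ : ℝ, 0 < κ → ∃ A : ℂ → ℝ, Tendsto A (𝓝[upperHalfPlaneSet] (τ : ℂ)) (𝓝 0) ∧
      ∀ z : ℂ, 0 < z.im → ‖z - τ‖ ≤ 1 / 2 → ∀ B : ℝ → ℝ, Integrable B μ → (∀ t, 0 ≤ B t) →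
        (∀ t, t ≠ τ → ‖(t : ℂ) - z‖ < κ * ‖z - τ‖ →
          bump τ t * ‖z - τ‖ / (|t - τ| * ‖(t : ℂ) - z‖) ≤ B t) →
        ‖f z - w‖ ≤ A z + 2 * ∫ t, B t ∂μ := by
  have := hμ.locallyFinite
  obtain ⟨w₀, hw₀⟩ := hf.exists_tendsto_sub_integral hμ τ
  set E : ℂ → ℂ := fun z => (1 - (z - τ) ^ 2) * f z -
      (1 / Real.pi : ℝ) * ∫ t : ℝ, (bump τ t / (t - z) : ℂ) ∂μ with hE
  set J : ℂ → ℂ := fun z => ∫ t : ℝ, (bump τ t / (t - z) : ℂ) ∂μ with hJ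
  set w := w₀ + (1 / Real.pi : ℝ) * J τ with hw
  refine ⟨w, fun κ hκ => ⟨fun z => 2 * (‖E z - w₀‖ + ‖z - τ‖ ^ 2 * ‖w‖ +
    ∫ t, farKernel τ κ z t ∂μ), ?_, fun z hz hz2 B hB hB0 hBz => ?_⟩⟩
  · have t1 : Tendsto (fun z => ‖E z - w₀‖) (𝓝[upperHalfPlaneSet] (τ : ℂ)) (𝓝 0) := by
      simpa using (hw₀.sub_const w₀).norm
    have t2 : Tendsto (fun z : ℂ => ‖z - τ‖ ^ 2 * ‖w‖) (𝓝[upperHalfPlaneSet] (τ : ℂ)) (𝓝 0) := by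
      have hc : ContinuousAt (fun z : ℂ => ‖z - τ‖ ^ 2 * ‖w‖) τ := by fun_prop
      simpa using hc.tendsto.mono_left nhdsWithin_le_nhds
    simpa using ((t1.add t2).add
      (tendsto_integral_farKernel hκ h0 hint upperHalfPlaneSet)).const_mul 2
  · have hI := norm_integral_sub_integral_le hκ h0 hint hz hB hB0 hBz
    change ‖J z - J τ‖ ≤ _ at hI
    have hpi : ‖((1 / Real.pi : ℝ) : ℂ)‖ ≤ 1 := by
      rw [Complex.norm_real, Real.norm_of_nonneg (by positivity), div_le_one Real.pi_pos]
      linarith [Real.pi_gt_three]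
    have e : (1 - (z - τ) ^ 2) * (f z - w) =
        (E z - w₀) + (1 / Real.pi : ℝ) * (J z - J τ) + (z - τ) ^ 2 * w := by
      change _ = ((1 - (z - τ) ^ 2) * f z - (1 / Real.pi : ℝ) * J z - w₀) + _ + _
      rw [hw]
      ring
    have h1 : ‖(1 - (z - τ) ^ 2) * (f z - w)‖ ≤
        ‖E z - w₀‖ + ‖J z - J τ‖ + ‖z - τ‖ ^ 2 * ‖w‖ := by
      rw [e]
      refine (norm_add₃_le).trans ?_
      rw [norm_mul, norm_mul, norm_pow]
      gcongr
      exact mul_le_of_le_one_left (norm_nonneg _) hpi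
    have h2 : 1 / 2 ≤ ‖1 - (z - τ) ^ 2‖ := by
      have := norm_sub_norm_le (1 : ℂ) ((z - τ) ^ 2)
      rw [norm_one, norm_pow] at this
      nlinarith [norm_nonneg (z - τ)]
    rw [norm_mul] at h1
    have h3 := mul_le_mul_of_nonneg_right h2 (norm_nonneg (f z - w))
    linarith

end

/-! ### Consequences of regularity, and the kernel in horocyclic regions. -/

section

variable {γ : ℝ≥0 → ℝ≥0}

lemma exists_le_mul_sq
    (hO : (fun t : ℝ≥0 => (γ t : ℝ)) =O[𝓝[>] 0] (fun t : ℝ≥0 => (t : ℝ) ^ 2)) :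
    ∃ K δ : ℝ≥0, 0 < K ∧ 0 < δ ∧ ∀ t : ℝ≥0, 0 < t → t < δ → γ t ≤ K * t ^ 2 := by
  obtain ⟨K, hK, h⟩ := hO.exists_pos
  obtain ⟨δ, hδ, h⟩ := (mem_nhdsGT_iff_exists_Ioo_subset).1 h.bound
  refine ⟨⟨K, hK.le⟩, δ, hK, hδ, fun t h1 h2 => ?_⟩
  have := h ⟨h1, h2⟩
  simp only [mem_ofPred_eq, Real.norm_eq_abs, NNReal.abs_eq, abs_pow] at this
  exact_mod_cast this

lemma eq_zero_of_isBigO_sq (hmono : Monotone γ)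
    (hO : (fun t : ℝ≥0 => (γ t : ℝ)) =O[𝓝[>] 0] (fun t : ℝ≥0 => (t : ℝ) ^ 2)) : γ 0 = 0 := by
  have h1 : Tendsto (fun t : ℝ≥0 => (t : ℝ) ^ 2) (𝓝[>] 0) (𝓝 0) := by
    have hc : ContinuousAt (fun t : ℝ≥0 => (t : ℝ) ^ 2) 0 := by fun_prop
    simpa using hc.tendsto.mono_left nhdsWithin_le_nhds
  have h2 := hO.trans_tendsto h1
  have h3 : (γ 0 : ℝ) ≤ 0 := ge_of_tendsto' h2 fun t => by exact_mod_cast hmono (zero_le (a := t))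
  exact le_antisymm (by exact_mod_cast h3) zero_le

/-- The consequences of `γ`-regularity for the Nevanlinna measure that govern the boundary
behaviour. -/
lemma IsRegularAt.exists_integrable {f : ℂ → ℂ} {τ : ℝ} (hmono : Monotone γ)
    (hpos : ∀ t : ℝ≥0, 0 < t → 0 < γ t)
    (hO : (fun t : ℝ≥0 => (γ t : ℝ)) =O[𝓝[>] 0] (fun t : ℝ≥0 => (t : ℝ) ^ 2))
    (h : IsRegularAt γ f τ) :
    ∃ μ : Measure ℝ, IsNevanlinnaMeasure f μ ∧ μ {τ} = 0 ∧
      Integrable (fun t => bump τ t * |t - τ|⁻¹) μ ∧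
      ∃ C : ℝ≥0, 0 < C ∧ ∃ r : ℝ, 0 < r ∧
        IntegrableOn (fun t => ((γ (C * nndist t τ))⁻¹ : ℝ)) (Metric.ball τ r) μ := by
  obtain ⟨μ, hμ, C, hC, U, hU, hfin⟩ := h
  have := hμ.locallyFinite
  obtain ⟨K, δ, hK, hδ, hγ⟩ := exists_le_mul_sq hO
  have hγm : Measurable fun t : ℝ => γ (C * nndist t τ) :=
    hmono.measurable.comp (measurable_const.mul (measurable_id.nndist measurable_const))
  obtain ⟨r₀, hr₀, hball⟩ := Metric.mem_nhds_iff.1 hU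
  -- Inside this radius the integrability hypothesis holds, `|t - τ|² ≤ |t - τ|`, and the quadratic
  -- bound on `γ` applies at `C|t - τ|`.
  set r : ℝ := min (min r₀ 1) (δ / C) with hr
  have hr0 : 0 < r := lt_min (lt_min hr₀ one_pos) (div_pos hδ hC)
  have hint : IntegrableOn (fun t => ((γ (C * nndist t τ))⁻¹ : ℝ)) (Metric.ball τ r) μ := by
    refine ⟨hγm.coe_nnreal_real.inv.aestronglyMeasurable, ?_⟩
    refine lt_of_le_of_lt ?_ hfin
    refine (lintegral_mono fun t => ?_).trans (lintegral_mono_set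
      ((Metric.ball_subset_ball ((min_le_left _ _).trans (min_le_left _ _))).trans hball))
    beta_reduce
    rw [← NNReal.coe_inv, ← ofReal_norm, NNReal.norm_eq, ENNReal.ofReal_coe_nnreal]
    -- Only an inequality: where `γ` vanishes the real inverse is `0`, the extended one `∞`.
    exact ENNReal.coe_inv_le
  -- As `γ 0 = 0`, an atom at `τ` would contribute an infinite integral.
  have h0 : μ {τ} = 0 := by
    by_contra hne
    have h1 : ∫⁻ t in {τ}, (γ (C * nndist t τ) : ℝ≥0∞)⁻¹ ∂μ < ∞ :=
      lt_of_le_of_lt (lintegral_mono_set (singleton_subset_iff.2 (mem_of_mem_nhds hU))) hfin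
    rw [lintegral_singleton] at h1
    simp [eq_zero_of_isBigO_sq hmono hO, ENNReal.top_mul hne] at h1
  refine ⟨μ, hμ, h0, ?_, C, hC, r, hr0, hint⟩
  have hb : Integrable (bump τ) μ :=
    (continuous_bump τ).integrable_of_hasCompactSupport (hasCompactSupport_bump τ)
  have hi := (integrable_indicator_iff measurableSet_ball).2 hint
  refine ((hb.const_mul r⁻¹).add (hi.const_mul (K * C ^ 2))).mono'
    (Measurable.aestronglyMeasurable (by have := (continuous_bump τ).measurable; fun_prop))
    (Eventually.of_forall fun t => ?_)
  have hbn := bump_nonneg τ t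
  have hb1 := bump_le_one τ t
  rw [Real.norm_of_nonneg (by positivity), Pi.add_apply]
  by_cases ht : t ∈ Metric.ball τ r
  · rw [indicator_of_mem ht]
    refine le_trans ?_ (le_add_of_nonneg_left (by positivity))
    rcases eq_or_ne t τ with rfl | hne
    · simp only [sub_self, abs_zero, inv_zero, mul_zero]
      positivity
    · have hd : 0 < nndist t τ := pos_iff_ne_zero.2 (nndist_eq_zero.not.2 hne)
      have hdd : (nndist t τ : ℝ) = |t - τ| := by rw [coe_nndist, Real.dist_eq]
      have htr : |t - τ| < r := by rwa [Metric.mem_ball, Real.dist_eq] at ht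
      have hp : 0 < |t - τ| := abs_pos.2 (sub_ne_zero.2 hne)
      have hlt : C * nndist t τ < δ := by
        have : |t - τ| < δ / C := htr.trans_le (min_le_right _ _)
        rw [lt_div_iff₀ (by exact_mod_cast hC), ← hdd, mul_comm] at this
        exact_mod_cast this
      have h1 := hγ _ (mul_pos hC hd) hlt
      have h1' : (γ (C * nndist t τ) : ℝ) ≤ K * (C * |t - τ|) ^ 2 := by
        rw [← hdd]; exact_mod_cast h1
      have hg : (0 : ℝ) < γ (C * nndist t τ) := hpos _ (mul_pos hC hd)
      have hlt1 : |t - τ| ≤ 1 := htr.le.trans ((min_le_left _ _).trans (min_le_right _ _))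
      calc bump τ t * |t - τ|⁻¹ ≤ 1 * |t - τ|⁻¹ := by gcongr
        _ ≤ K * C ^ 2 * (γ (C * nndist t τ) : ℝ)⁻¹ := by
          rw [one_mul, ← div_eq_mul_inv, le_div_iff₀ hg, inv_mul_le_iff₀ hp]
          refine h1'.trans ?_
          have : (0 : ℝ) ≤ K * C ^ 2 := by positivity
          nlinarith
  · rw [indicator_of_notMem ht, mul_zero, add_zero, mul_comm]
    refine mul_le_mul_of_nonneg_right (inv_anti₀ hr0 ?_) hbn
    rwa [Metric.mem_ball, Real.dist_eq, not_lt] at ht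

/-- For near `t` one has `|t - τ| ≤ 2|Re z - τ| ≤ 2c`. So `D γ(C|t - τ|) ≤ D γ(2C c) ≤ Im z ≤ |t -
z|`; this is why the region carries `2C`. -/
lemma div_mul_norm_le_of_mem_horoRegion {τ : ℝ} (hmono : Monotone γ)
    (hpos : ∀ t : ℝ≥0, 0 < t → 0 < γ t) {C D : ℝ≥0} (hC : 0 < C) (hD : 0 < D) {z : ℂ}
    (hz : z ∈ horoRegion γ τ (2 * C) D) {t : ℝ} (ht : t ≠ τ)
    (hlt : ‖(t : ℂ) - z‖ < 1 / 2 * ‖z - τ‖) :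
    |t - τ| < 3 / 2 * ‖z - τ‖ ∧ bump τ t * ‖z - τ‖ / (|t - τ| * ‖(t : ℂ) - z‖) ≤
      2 / D * ((γ (C * nndist t τ))⁻¹ : ℝ) := by
  obtain ⟨hz0, c, hc, hy, hx⟩ := mem_lamStolzRegion_iff.1 hz.1
  have hyt := im_le_norm_ofReal_sub (z := z) t
  have hnt : ‖(t : ℂ) - τ‖ = |t - τ| := by
    rw [← Complex.ofReal_sub, Complex.norm_real, Real.norm_eq_abs]
  have hp : 0 < |t - τ| := abs_pos.2 (sub_ne_zero.2 ht)
  have h1 : |t - τ| < 3 / 2 * ‖z - τ‖ := by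
    have := norm_sub_le_norm_sub_add_norm_sub (t : ℂ) z τ
    rw [hnt] at this
    linarith
  refine ⟨h1, ?_⟩
  have h2 : ‖z - τ‖ ≤ 2 * |t - τ| := by
    have := norm_sub_le_norm_sub_add_norm_sub z (t : ℂ) τ
    rw [hnt, norm_sub_rev z (t : ℂ)] at this
    linarith
  -- Here `Im z ≤ |t - z| < |z - τ| / 2`, so `|Re z - τ|` exceeds `(√3/2)|z - τ|`.
  have h3 : |t - τ| ≤ 2 * |z.re - τ| := by
    have h4 : ‖z - τ‖ ^ 2 = |z.re - τ| ^ 2 + z.im ^ 2 := by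
      rw [Complex.sq_norm, Complex.normSq_apply, sq_abs]
      simp
      ring
    nlinarith [norm_nonneg (z - τ), abs_nonneg (z.re - τ)]
  have hdd : (nndist t τ : ℝ) = |t - τ| := by rw [coe_nndist, Real.dist_eq]
  have hg : (0 : ℝ) < γ (C * nndist t τ) := hpos _ (mul_pos hC (pos_iff_ne_zero.2 (nndist_eq_zero.not.2 ht)))
  have h4 : γ (C * nndist t τ) ≤ γ (2 * C * c) := by
    apply hmono
    rw [← NNReal.coe_le_coe]
    push_cast
    rw [← coe_nndist, hdd]
    have : (0 : ℝ) ≤ C := C.2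
    nlinarith
  have h5 : (D : ℝ) * γ (C * nndist t τ) ≤ z.im := by
    refine le_trans ?_ hy
    push_cast
    exact mul_le_mul_of_nonneg_left (by exact_mod_cast h4) D.2
  have hD' : (0 : ℝ) < D := hD
  have hn : 0 < ‖(t : ℂ) - z‖ := hz0.trans_le hyt
  rw [div_mul_eq_mul_div, ← div_eq_mul_inv, div_div, div_le_div_iff₀ (by positivity) (by positivity)]
  calc bump τ t * ‖z - τ‖ * (γ (C * nndist t τ) * D)
      ≤ 1 * (2 * |t - τ|) * ‖(t : ℂ) - z‖ := by
        gcongr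
        · exact bump_le_one _ _
        · linarith
    _ = 2 * (|t - τ| * ‖(t : ℂ) - z‖) := by ring

end

/-! ### Horocyclic continuity. -/

section

variable {γ : ℝ≥0 → ℝ≥0}

lemma supDist_le {f : ℂ → ℂ} {w : ℂ} {S : Set ℂ} {b : ℝ} (h : ∀ z ∈ S, ‖f z - w‖ ≤ b) :
    supDist f w S ≤ ENNReal.ofReal b :=
  iSup₂_le fun z hz => by
    rw [← ofReal_norm]
    exact ENNReal.ofReal_le_ofReal (h z hz)

/-- A point away from `τ` is either high or horizontally distant. In the latter case `c ≥ δ/2`, and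
monotonicity of `γ` bounds the height below. -/
lemma exists_le_im_of_mem_horoRegion {τ δ : ℝ} (hmono : Monotone γ)
    (hpos : ∀ t : ℝ≥0, 0 < t → 0 < γ t) {C D : ℝ≥0} (hC : 0 < C) (hD : 0 < D) (hδ : 0 < δ) :
    ∃ m : ℝ, 0 < m ∧ ∀ z ∈ horoRegion γ τ C D, δ ≤ ‖z - τ‖ → m ≤ z.im := by
  set d : ℝ≥0 := ⟨δ / 2, by positivity⟩ with hd
  have hd0 : 0 < d := by rw [← NNReal.coe_pos]; exact half_pos hδ
  have hg : (0 : ℝ) < D * γ (C * d) := by exact_mod_cast mul_pos hD (hpos _ (mul_pos hC hd0))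
  refine ⟨min (δ / 2) (D * γ (C * d)), lt_min (half_pos hδ) hg, fun z hz hzδ => ?_⟩
  obtain ⟨hz0, c, hc, hy, hx⟩ := mem_lamStolzRegion_iff.1 hz.1
  rcases le_or_gt (δ / 2) z.im with h | h
  · exact (min_le_left _ _).trans h
  · refine (min_le_right _ _).trans (le_trans ?_ hy)
    have h1 := Complex.norm_le_abs_re_add_abs_im (z - τ)
    simp only [Complex.sub_re, Complex.ofReal_re, Complex.sub_im, Complex.ofReal_im, sub_zero,
      abs_of_pos hz0] at h1
    have h2 : d ≤ c := by
      rw [← NNReal.coe_le_coe]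
      change δ / 2 ≤ (c : ℝ)
      linarith
    have h3 : γ (C * d) ≤ γ (C * c) := hmono (by gcongr)
    push_cast
    gcongr

theorem IsRegularAt.isHorocyclicallyContinuousAt {f : ℂ → ℂ} {τ : ℝ} (hmono : Monotone γ)
    (hpos : ∀ t : ℝ≥0, 0 < t → 0 < γ t)
    (hO : (fun t : ℝ≥0 => (γ t : ℝ)) =O[𝓝[>] 0] (fun t : ℝ≥0 => (t : ℝ) ^ 2))
    (hf : IsPick f) (h : IsRegularAt γ f τ) : IsHorocyclicallyContinuousAt γ f τ := by
  obtain ⟨μ, hμ, h0, hint, C, hC, r, hr, hintr⟩ := h.exists_integrable hmono hpos hO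
  obtain ⟨w, hw⟩ := hf.exists_norm_sub_le hμ h0 hint
  refine ⟨w, fun M hM => ?_, 2 * C, mul_pos two_pos hC, ?_⟩
  · obtain ⟨A, hA, hAf⟩ := hw M hM
    have hsub : stolzRegion upperHalfPlaneSet τ M ⊆ upperHalfPlaneSet := fun z hz => hz.1
    rw [tendsto_iff_norm_sub_tendsto_zero]
    refine squeeze_zero' (Eventually.of_forall fun z => norm_nonneg _) ?_
      (hA.mono_left (nhdsWithin_mono _ hsub))
    filter_upwards [self_mem_nhdsWithin, mem_nhdsWithin_of_mem_nhds
      (Metric.closedBall_mem_nhds (τ : ℂ) (by norm_num : (0 : ℝ) < 1 / 2))] with z h1 h2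
    obtain ⟨hz0, hz1⟩ := mem_stolzRegion_iff.1 h1
    -- With `κ = M` the near set is empty, because `|t - z| ≥ Im z ≥ M|z - τ|`; so `B = 0`.
    have := hAf z hz0 (by simpa [dist_eq_norm] using h2) (fun _ => 0) (integrable_zero _ _ _)
      (fun _ => le_rfl) fun t _ hlt =>
        absurd (hz1.trans (im_le_norm_ofReal_sub t)) (not_le.2 hlt)
    simpa using this
  · obtain ⟨A, hA, hAf⟩ := hw (1 / 2) one_half_pos
    set H : ℝ := ∫ t in Metric.ball τ r, ((γ (C * nndist t τ))⁻¹ : ℝ) ∂μ with hH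
    have near : ∀ D : ℝ≥0, 0 < D → ∀ z ∈ horoRegion γ τ (2 * C) D, ‖z - τ‖ ≤ 1 / 2 →
        ‖z - τ‖ ≤ 2 / 3 * r → ‖f z - w‖ ≤ A z + 4 / D * H := fun D hD z hz hz1 hz2 => by
      have hz0 : 0 < z.im := (mem_lamStolzRegion_iff.1 hz.1).1
      have := hAf z hz0 hz1
        (fun t => 2 / D * (Metric.ball τ r).indicator (fun t => ((γ (C * nndist t τ))⁻¹ : ℝ)) t)
        (((integrable_indicator_iff measurableSet_ball).2 hintr).const_mul _)
        (fun t => mul_nonneg (by positivity) (indicator_nonneg (fun t _ => by positivity) t))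
        (fun t ht hlt => by
          obtain ⟨h1, h2⟩ := div_mul_norm_le_of_mem_horoRegion hmono hpos hC hD hz ht hlt
          have : t ∈ Metric.ball τ r := by
            rw [Metric.mem_ball, Real.dist_eq]
            linarith
          rwa [indicator_of_mem this])
      rw [integral_const_mul, integral_indicator measurableSet_ball, ← hH] at this
      refine this.trans (le_of_eq ?_)
      ring
    have small : ∀ ε : ℝ, 0 < ε → ∃ δ : ℝ, 0 < δ ∧ ∀ z : ℂ, 0 < z.im → ‖z - τ‖ < δ →
        A z < ε ∧ ‖z - τ‖ ≤ 1 / 2 ∧ ‖z - τ‖ ≤ 2 / 3 * r := fun ε hε => by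
      obtain ⟨δ, hδ, hδA⟩ := Metric.mem_nhdsWithin_iff.1 (hA.eventually_lt_const hε)
      refine ⟨min δ (min (1 / 2) (2 / 3 * r)), by positivity, fun z hz hzδ => ?_⟩
      rw [lt_min_iff, lt_min_iff] at hzδ
      refine ⟨hδA ⟨?_, hz⟩, hzδ.2.1.le, hzδ.2.2.le⟩
      rw [Metric.mem_ball, dist_eq_norm]
      exact hzδ.1
    constructor
    · intro D hD
      obtain ⟨δ, hδ, hδA⟩ := small 1 one_pos
      obtain ⟨m, hm, hmz⟩ := exists_le_im_of_mem_horoRegion (τ := τ) hmono hpos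
        (mul_pos two_pos hC) hD hδ
      -- Away from `τ` the region lies in a compact subset of the open half plane, where `f` is
      -- bounded.
      have hcomp : IsCompact (Metric.closedBall (τ : ℂ) (1 / D) ∩ {z : ℂ | m ≤ z.im}) :=
        (isCompact_closedBall _ _).inter_right
          (isClosed_le continuous_const Complex.continuous_im)
      obtain ⟨b, hb⟩ := hcomp.exists_bound_of_continuousOn (f := fun z => f z - w)
        ((hf.analytic.continuousOn.mono fun z hz => hm.trans_le hz.2).sub continuousOn_const)
      refine (supDist_le (b := max (1 + 4 / D * H) b) fun z hz => ?_).trans_lt ENNReal.ofReal_lt_top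
      have hz0 : 0 < z.im := (mem_lamStolzRegion_iff.1 hz.1).1
      rcases lt_or_ge ‖z - τ‖ δ with hlt | hge
      · obtain ⟨h1, h2, h3⟩ := hδA z hz0 hlt
        exact ((near D hD z hz h2 h3).trans (by linarith)).trans (le_max_left _ _)
      · exact (hb z ⟨Metric.ball_subset_closedBall hz.2, hmz z hz hge⟩).trans (le_max_right _ _)
    · rw [ENNReal.tendsto_nhds_zero]
      intro ε hε
      obtain ⟨e, he0, he⟩ := ENNReal.lt_iff_exists_nnreal_btwn.1 hε
      have he0 : (0 : ℝ) < e := by exact_mod_cast he0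
      obtain ⟨δ, hδ, hδA⟩ := small (e / 2) (half_pos he0)
      have hcoe : Tendsto (fun D : ℝ≥0 => (D : ℝ)) atTop atTop := NNReal.tendsto_coe_atTop.2 tendsto_id
      have l1 : Tendsto (fun D : ℝ≥0 => 1 / (D : ℝ)) atTop (𝓝 0) := hcoe.const_div_atTop 1
      have l2 : Tendsto (fun D : ℝ≥0 => 4 / (D : ℝ) * H) atTop (𝓝 0) := by
        simpa using (hcoe.const_div_atTop 4).mul_const H
      -- Large `D` serves twice: the ball of radius `1/D` makes `A` small, and the near part is at
      -- most `4H/D`.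
      filter_upwards [eventually_gt_atTop 0, l1.eventually_lt_const hδ,
        l2.eventually_lt_const (half_pos he0)] with D hD h1 h2
      refine le_trans (supDist_le (b := e) fun z hz => ?_) (by simpa using he.le)
      have hz0 : 0 < z.im := (mem_lamStolzRegion_iff.1 hz.1).1
      have hzb := hz.2
      rw [Metric.mem_ball, dist_eq_norm] at hzb
      obtain ⟨h3, h4, h5⟩ := hδA z hz0 (hzb.trans h1)
      linarith [near D hD z hz h4 h5]

end

/-! ### Sums of poles and their Nevanlinna measures. -/

section

/-- Substituting `x = a + y s` moves `y` from the kernel to the test function, leaving a fixed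
integrable weight. -/
lemma integral_mul_poisson (g : ℝ → ℝ) (a : ℝ) {y : ℝ} (hy : 0 < y) :
    ∫ x, g x * (y / ((a - x) ^ 2 + y ^ 2)) = ∫ s, g (a + y * s) * (1 + s ^ 2)⁻¹ := by
  rw [← integral_add_left_eq_self (fun x => g x * (y / ((a - x) ^ 2 + y ^ 2))) a]
  have h := Measure.integral_comp_mul_left
    (fun x => g (a + x) * (y / ((a - (a + x)) ^ 2 + y ^ 2))) y
  rw [abs_of_pos (inv_pos.2 hy), smul_eq_mul, eq_inv_mul_iff_mul_eq₀ hy.ne',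
    ← integral_const_mul] at h
  rw [← h]
  congr 1 with s
  have : (0 : ℝ) < 1 + s ^ 2 := by positivity
  have h2 : (a - (a + y * s)) ^ 2 + y ^ 2 = y ^ 2 * (1 + s ^ 2) := by ring
  rw [h2]
  field_simp

lemma abs_integral_mul_inv_one_add_sq_le {g : ℝ → ℝ} {b : ℝ} (hb : ∀ x, |g x| ≤ b) :
    |∫ s, g s * (1 + s ^ 2)⁻¹| ≤ b * Real.pi := by
  rw [← integral_univ_inv_one_add_sq, ← integral_const_mul, ← Real.norm_eq_abs]
  refine norm_integral_le_of_norm_le (integrable_inv_one_add_sq.const_mul b)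
    (Eventually.of_forall fun s => ?_)
  rw [norm_mul, Real.norm_eq_abs, Real.norm_of_nonneg (by positivity)]
  exact mul_le_mul_of_nonneg_right (hb s) (by positivity)

lemma tendsto_integral_mul_poisson {g : ℝ → ℝ} (hg : Continuous g) {b : ℝ} (hb : ∀ x, |g x| ≤ b)
    (a : ℝ) :
    Tendsto (fun y : ℝ => ∫ x, g x * (y / ((a - x) ^ 2 + y ^ 2))) (𝓝[>] 0)
      (𝓝 (g a * Real.pi)) := by
  have hlim : g a * Real.pi = ∫ s : ℝ, g a * (1 + s ^ 2)⁻¹ := by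
    rw [integral_const_mul, integral_univ_inv_one_add_sq]
  rw [hlim]
  have key : Tendsto (fun y : ℝ => ∫ s, g (a + y * s) * (1 + s ^ 2)⁻¹) (𝓝[>] 0)
      (𝓝 (∫ s : ℝ, g a * (1 + s ^ 2)⁻¹)) := by
    refine tendsto_integral_filter_of_dominated_convergence (fun s => b * (1 + s ^ 2)⁻¹)
      (Eventually.of_forall fun y => Measurable.aestronglyMeasurable
        (by have := hg.measurable; fun_prop))
      (Eventually.of_forall fun y => Eventually.of_forall fun s => ?_)
      (integrable_inv_one_add_sq.const_mul b) (Eventually.of_forall fun s => ?_)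
    · rw [norm_mul, Real.norm_eq_abs, Real.norm_of_nonneg (by positivity)]
      exact mul_le_mul_of_nonneg_right (hb _) (by positivity)
    · have hc : ContinuousAt (fun y : ℝ => g (a + y * s) * (1 + s ^ 2)⁻¹) 0 := by fun_prop
      have := hc.tendsto.mono_left (nhdsWithin_le_nhds (s := Ioi 0))
      simpa using this
  refine key.congr' ?_
  filter_upwards [self_mem_nhdsWithin] with y hy
  exact (integral_mul_poisson g a hy).symm

/-- The Cauchy transform of point masses `m n` at the points `x n`. -/
noncomputable def poleSum (m x : ℕ → ℝ) (z : ℂ) : ℂ := ∑' n, (m n : ℂ) / ((x n : ℂ) - z)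

variable {m x : ℕ → ℝ}

lemma norm_pole_le (hm : ∀ n, 0 ≤ m n) {z : ℂ} {δ : ℝ} (hδ : 0 < δ) (hz : δ ≤ z.im) (n : ℕ) :
    ‖(m n : ℂ) / ((x n : ℂ) - z)‖ ≤ m n * δ⁻¹ := by
  rw [norm_div, Complex.norm_real, Real.norm_of_nonneg (hm n), div_eq_mul_inv]
  exact mul_le_mul_of_nonneg_left (inv_anti₀ hδ (hz.trans (im_le_norm_ofReal_sub _))) (hm n)

lemma im_pole (z : ℂ) (n : ℕ) :
    ((m n : ℂ) / ((x n : ℂ) - z)).im = m n * (z.im / ((x n - z.re) ^ 2 + z.im ^ 2)) := by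
  rw [div_eq_mul_inv, Complex.im_ofReal_mul, Complex.inv_im, Complex.normSq_apply]
  simp
  left
  ring

lemma hasSum_im_poleSum (hm : ∀ n, 0 ≤ m n) (hs : Summable m) {z : ℂ} (hz : 0 < z.im) :
    HasSum (fun n => m n * (z.im / ((x n - z.re) ^ 2 + z.im ^ 2))) (poleSum m x z).im := by
  have h : Summable fun n => (m n : ℂ) / ((x n : ℂ) - z) :=
    (hs.mul_right z.im⁻¹).of_norm_bounded (norm_pole_le hm hz le_rfl)
  simpa only [im_pole, poleSum] using Complex.hasSum_im h.hasSum

lemma isPick_poleSum (hm : ∀ n, 0 ≤ m n) (hs : Summable m) : IsPick (poleSum m x) := by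
  constructor
  · intro z hz
    have hz0 : 0 < z.im := hz
    have hU : IsOpen {w : ℂ | z.im / 2 < w.im} := isOpen_lt continuous_const Complex.continuous_im
    have hd : DifferentiableOn ℂ (poleSum m x) {w : ℂ | z.im / 2 < w.im} :=
      Complex.differentiableOn_tsum_of_summable_norm (hs.mul_right (z.im / 2)⁻¹)
        (fun n => DifferentiableOn.div (by fun_prop) (by fun_prop) fun w hw =>
          ofReal_sub_ne_zero ((half_pos hz0).trans hw) _) hU
        fun n w hw => norm_pole_le hm (half_pos hz0) (le_of_lt hw) n
    exact (hd.differentiableAt (hU.mem_nhds (half_lt_self hz0))).differentiableWithinAt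
  · intro z hz
    rw [show closure upperHalfPlaneSet = {w : ℂ | 0 ≤ w.im} from
      Complex.closure_setOfPred_lt_im 0]
    have hz0 : 0 < z.im := hz
    refine (hasSum_im_poleSum hm hs hz0).nonneg fun n => ?_
    have := hm n
    positivity

/-- The sum of point masses `π * m n` at the points `x n`. -/
noncomputable def poleMeasure (m x : ℕ → ℝ) : Measure ℝ :=
  Measure.sum fun n => ENNReal.ofReal (Real.pi * m n) • Measure.dirac (x n)

/-- The imaginary part of one pole is `m n` times a Poisson kernel of total mass `π`. The limit is
taken pole by pole, dominated by the summable `m n · bπ`. -/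
lemma isNevanlinnaMeasure_poleSum (hm : ∀ n, 0 ≤ m n) (hs : Summable m) :
    IsNevanlinnaMeasure (poleSum m x) (poleMeasure m x) := by
  have hpm : ∀ n, 0 ≤ Real.pi * m n := fun n => mul_nonneg Real.pi_pos.le (hm n)
  constructor
  · have : IsFiniteMeasure (poleMeasure m x) := by
      constructor
      rw [poleMeasure, Measure.sum_apply _ MeasurableSet.univ]
      simpa using (hs.mul_left Real.pi).tsum_ofReal_lt_top
    infer_instance
  · intro φ hφ hsupp
    obtain ⟨b, hb⟩ := hφ.bounded_above_of_compact_support hsupp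
    have hb0 : 0 ≤ b := (norm_nonneg _).trans (hb 0)
    have hlim : ∫ t, φ t ∂(poleMeasure m x) = ∑' n, m n * (φ (x n) * Real.pi) := by
      rw [poleMeasure, integral_sum_dirac_eq_tsum]
      · refine tsum_congr fun n => ?_
        rw [ENNReal.toReal_ofReal (hpm n), smul_eq_mul]
        ring
      · exact fun n => ENNReal.ofReal_ne_top
      · refine ((hs.mul_left Real.pi).mul_right b).of_nonneg_of_le (fun n => by positivity)
          fun n => ?_
        rw [ENNReal.toReal_ofReal (hpm n)]
        exact mul_le_mul_of_nonneg_left (hb _) (hpm n)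
    rw [hlim]
    have key : Tendsto (fun y : ℝ => ∑' n, m n * ∫ t, φ t * (y / ((x n - t) ^ 2 + y ^ 2))) (𝓝[>] 0)
        (𝓝 (∑' n, m n * (φ (x n) * Real.pi))) := by
      refine tendsto_tsum_of_dominated_convergence (hs.mul_right (b * Real.pi))
        (fun n => (tendsto_integral_mul_poisson hφ hb (x n)).const_mul _) ?_
      filter_upwards [self_mem_nhdsWithin] with y hy n
      rw [norm_mul, Real.norm_of_nonneg (hm n), integral_mul_poisson φ _ hy]
      exact mul_le_mul_of_nonneg_left
        (abs_integral_mul_inv_one_add_sq_le (g := fun s => φ (x n + y * s)) fun s => hb _) (hm n)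
    refine key.congr' ?_
    filter_upwards [self_mem_nhdsWithin] with y hy
    have hy : 0 < y := hy
    have hint : ∀ (g : ℝ → ℝ), Continuous g → HasCompactSupport g → ∀ n,
        Integrable fun t => g t * (y / ((x n - t) ^ 2 + y ^ 2)) := fun g hg hgs n => by
      refine Continuous.integrable_of_hasCompactSupport ?_ hgs.mul_right
      exact hg.mul (continuous_const.div (by fun_prop) fun t => by positivity)
    have hsw := hasSum_integral_of_summable_integral_norm
      (F := fun n t => m n * (φ t * (y / ((x n - t) ^ 2 + y ^ 2)))) (μ := volume)
      (fun n => (hint φ hφ hsupp n).const_mul _) (by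
        refine (hs.mul_right (b * Real.pi)).of_nonneg_of_le
          (fun n => integral_nonneg fun t => norm_nonneg _) fun n => ?_
        have e : ∀ t, ‖m n * (φ t * (y / ((x n - t) ^ 2 + y ^ 2)))‖ =
            m n * (‖φ t‖ * (y / ((x n - t) ^ 2 + y ^ 2))) := fun t => by
          rw [norm_mul, norm_mul, Real.norm_of_nonneg (hm n), Real.norm_of_nonneg
            (show 0 ≤ y / ((x n - t) ^ 2 + y ^ 2) by positivity)]
        simp only [e]
        rw [integral_const_mul, integral_mul_poisson (fun t => ‖φ t‖) _ hy]
        refine mul_le_mul_of_nonneg_left ((le_abs_self _).trans ?_) (hm n)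
        exact abs_integral_mul_inv_one_add_sq_le (g := fun s => ‖φ (x n + y * s)‖)
          fun s => by simpa using hb _)
    simp only [integral_const_mul] at hsw
    rw [hsw.tsum_eq]
    congr 1 with t
    have := (hasSum_im_poleSum (x := x) hm hs (z := t + y * Complex.I) (by simpa using hy)).tsum_eq
    rw [← this, ← tsum_mul_left]
    refine tsum_congr fun n => ?_
    simp
    ring

lemma isRegularAt_poleSum {γ : ℝ≥0 → ℝ≥0} {τ : ℝ} {C : ℝ≥0} (hC : 0 < C)
    (hm : ∀ n, 0 ≤ m n) (hs : Summable m)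
    (hpos : ∀ n, 0 < γ (C * nndist (x n) τ))
    (hsum : Summable fun n => m n / γ (C * nndist (x n) τ)) :
    IsRegularAt γ (poleSum m x) τ := by
  refine ⟨_, isNevanlinnaMeasure_poleSum hm hs, C, hC, univ, univ_mem, ?_⟩
  rw [setLIntegral_univ, poleMeasure, lintegral_sum_measure]
  have e : ∀ n, ∫⁻ t, (γ (C * nndist t τ) : ℝ≥0∞)⁻¹
      ∂(ENNReal.ofReal (Real.pi * m n) • Measure.dirac (x n)) =
      ENNReal.ofReal (Real.pi * (m n / γ (C * nndist (x n) τ))) := fun n => by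
    have hg : (0 : ℝ) < γ (C * nndist (x n) τ) := hpos n
    rw [lintegral_smul_measure, lintegral_dirac, smul_eq_mul, ← mul_div_assoc,
      ENNReal.ofReal_div_of_pos hg, ENNReal.ofReal_coe_nnreal, div_eq_mul_inv]
  simp only [e]
  exact (hsum.mul_left Real.pi).tsum_ofReal_lt_top

/-- All terms of the imaginary part are nonnegative, so one may be kept alone. -/
lemma le_im_poleSum (hm : ∀ n, 0 ≤ m n) (hs : Summable m) (n : ℕ) {y : ℝ} (hy : 0 < y) :
    m n / y ≤ (poleSum m x (x n + y * Complex.I)).im := by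
  have h := hasSum_im_poleSum (x := x) hm hs (z := x n + y * Complex.I) (by simpa using hy)
  have h1 := le_hasSum h n fun k _ => by
    have := hm k
    have : (0 : ℝ) ≤ ((x n : ℂ) + y * Complex.I).im := by simpa using hy.le
    positivity
  refine le_trans (le_of_eq ?_) h1
  simp
  field_simp

/-! ### Sharpness. -/

theorem exists_isPick_supDist_eq_top {γ lam : ℝ≥0 → ℝ≥0} {τ : ℝ} {C : ℝ≥0} (hmono : Monotone γ)
    (hpos : ∀ t : ℝ≥0, 0 < t → 0 < γ t) (hC : 0 < C)
    (hlam : (fun t : ℝ≥0 => (lam t : ℝ)) =o[𝓝[>] 0] (fun t : ℝ≥0 => (γ (C * t) : ℝ))) :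
    ∃ f : ℂ → ℂ, IsPick f ∧ IsRegularAt γ f τ ∧ ∀ (w : ℂ) (r : ℝ), 0 < r →
      supDist f w (lamStolzRegion upperHalfPlaneSet τ lam ∩ Metric.ball (τ : ℂ) r) = ∞ := by
  -- The factor `(1/2)ⁿ` makes the masses summable against `1/γ`; the extra `1/(n + 1)` leaves room
  -- for the values to grow.
  have hex : ∀ n : ℕ, ∃ t : ℝ≥0, 0 < t ∧ t ≤ 1 / (n + 1) ∧
      (lam t : ℝ) ≤ (1 / 2) ^ n / (n + 1) * γ (C * t) := fun n => by
    have h1 := hlam.bound (c := (1 / 2) ^ n / (n + 1)) (by positivity)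
    have h2 : Ioc (0 : ℝ≥0) (1 / (n + 1)) ∈ 𝓝[>] (0 : ℝ≥0) := Ioc_mem_nhdsGT (by positivity)
    obtain ⟨t, ht1, ht2⟩ := (h1.and h2).exists
    exact ⟨t, ht2.1, ht2.2, by simpa using ht1⟩
  choose t ht0 ht1 htl using hex
  set m : ℕ → ℝ := fun n => (1 / 2) ^ n * γ (C * t n) with hmdef
  set x : ℕ → ℝ := fun n => τ + t n with hx
  have hγ0 : ∀ n, (0 : ℝ) < γ (C * t n) := fun n => hpos _ (mul_pos hC (ht0 n))
  have hγ1 : ∀ n, (γ (C * t n) : ℝ) ≤ γ C := fun n => by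
    have : t n ≤ 1 := (ht1 n).trans (div_le_one_of_le₀ (by simp) (by positivity))
    exact_mod_cast hmono (mul_le_of_le_one_right' this)
  have hm0 : ∀ n, 0 < m n := fun n => mul_pos (by positivity) (hγ0 n)
  have hm : ∀ n, 0 ≤ m n := fun n => (hm0 n).le
  have hs : Summable m := (summable_geometric_two.mul_right (γ C : ℝ)).of_nonneg_of_le hm
    fun n => mul_le_mul_of_nonneg_left (hγ1 n) (by positivity)
  have hnd : ∀ n, nndist (x n) τ = t n := fun n => by
    rw [← NNReal.coe_inj, coe_nndist, Real.dist_eq]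
    simp [hx]
  refine ⟨poleSum m x, isPick_poleSum hm hs, isRegularAt_poleSum hC hm hs
    (fun n => by rw [hnd]; exact hγ0 n) ?_, fun w r hr => ?_⟩
  · refine summable_geometric_two.congr fun n => ?_
    rw [hnd, hmdef]
    exact (mul_div_cancel_right₀ _ (hγ0 n).ne').symm
  · refine ENNReal.eq_top_of_forall_nnreal_le fun b => ?_
    have l1 : Tendsto (fun n : ℕ => (1 + (γ C : ℝ)) * (1 / ((n : ℝ) + 1))) atTop (𝓝 0) := by
      simpa using tendsto_one_div_add_atTop_nhds_zero_nat.const_mul (1 + (γ C : ℝ))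
    obtain ⟨n, hn1, hn2⟩ := ((l1.eventually_lt_const hr).and
      (tendsto_natCast_atTop_atTop.eventually_ge_atTop (b + ‖w‖))).exists
    -- The height is just the bound on `lam (t n)`, so the point lies in the region, and `m n / y =
    -- n + 1`.
    set y : ℝ := m n / (n + 1) with hy
    have hy0 : 0 < y := div_pos (hm0 n) (by positivity)
    have hz : (x n + y * Complex.I : ℂ) ∈
        lamStolzRegion upperHalfPlaneSet τ lam ∩ Metric.ball (τ : ℂ) r := by
      constructor
      · refine mem_lamStolzRegion_iff.2 ⟨by simpa using hy0, t n, ht0 n, ?_, ?_⟩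
        · refine (htl n).trans (le_of_eq ?_)
          rw [show (x n + y * Complex.I : ℂ).im = y by simp, hy, hmdef]
          ring
        · simp [hx]
      · rw [Metric.mem_ball, dist_eq_norm]
        refine lt_of_le_of_lt ((Complex.norm_le_abs_re_add_abs_im _).trans ?_) hn1
        have h1 : (t n : ℝ) ≤ 1 / ((n : ℝ) + 1) := by exact_mod_cast ht1 n
        have h2 : y ≤ γ C * (1 / ((n : ℝ) + 1)) := by
          rw [hy, div_eq_mul_one_div]
          refine mul_le_mul_of_nonneg_right ?_ (by positivity)
          refine (mul_le_of_le_one_left (hγ0 n).le ?_).trans (hγ1 n)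
          exact pow_le_one₀ (by norm_num) (by norm_num)
        simp only [hx, Complex.sub_re, Complex.add_re, Complex.ofReal_re, Complex.mul_re,
          Complex.I_re, mul_zero, Complex.ofReal_im, Complex.I_im, mul_one, sub_self, add_zero,
          add_sub_cancel_left, NNReal.abs_eq, Complex.sub_im, Complex.add_im, Complex.mul_im,
          zero_add, sub_zero, abs_of_pos hy0]
        linarith
    refine le_trans ?_ (le_iSup₂ (f := fun z _ => ‖poleSum m x z - w‖ₑ) _ hz)
    rw [← ofReal_norm, ← ENNReal.ofReal_coe_nnreal]
    refine ENNReal.ofReal_le_ofReal ?_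
    have h1 := le_im_poleSum (x := x) hm hs n hy0
    have h2 : m n / y = n + 1 := by
      rw [hy]
      field_simp [(hm0 n).ne']
    have h3 := (Complex.im_le_norm (poleSum m x (x n + y * Complex.I))).trans
      (norm_le_norm_sub_add _ w)
    linarith

end

end Horocyclic

theorem mainTheorem3 (γ : ℝ≥0 → ℝ≥0) (hmono : Monotone γ) (hpos : ∀ t : ℝ≥0, 0 < t → 0 < γ t)
    (hO : (fun t : ℝ≥0 => (γ t : ℝ)) =O[𝓝[>] 0] (fun t : ℝ≥0 => (t : ℝ) ^ 2)) (τ : ℝ) :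
    (∀ f : ℂ → ℂ, Horocyclic.IsPick f → Horocyclic.IsRegularAt γ f τ →
      Horocyclic.IsHorocyclicallyContinuousAt γ f τ) ∧
    (∀ lam : ℝ≥0 → ℝ≥0,
      (∃ C : ℝ≥0, 0 < C ∧
        (fun t : ℝ≥0 => (lam t : ℝ)) =o[𝓝[>] 0] (fun t : ℝ≥0 => (γ (C * t) : ℝ))) →
      ∃ f : ℂ → ℂ, Horocyclic.IsPick f ∧ Horocyclic.IsRegularAt γ f τ ∧
        ∃ w : ℂ, Horocyclic.HasNontangentialValue f τ w ∧
          Horocyclic.supDist f w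
            (Horocyclic.lamStolzRegion upperHalfPlaneSet τ lam) = ∞ ∧
          ∀ r : ℝ, 0 < r →
            Horocyclic.supDist f w
              (Horocyclic.lamStolzRegion upperHalfPlaneSet τ lam ∩ Metric.ball (τ : ℂ) r) = ∞) := by
  refine ⟨fun f hf hreg => hreg.isHorocyclicallyContinuousAt hmono hpos hO hf, ?_⟩
  rintro lam ⟨C, hC, hlam⟩
  obtain ⟨f, hf, hreg, hsup⟩ := Horocyclic.exists_isPick_supDist_eq_top (τ := τ) hmono hpos hC hlam
  -- The nontangential value comes from the first half; the blow-up holds against every `w`.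
  obtain ⟨w, hw, -⟩ := hreg.isHorocyclicallyContinuousAt hmono hpos hO hf
  refine ⟨f, hf, hreg, w, hw, ?_, hsup w⟩
  exact eq_top_mono (biSup_mono fun z hz => hz.1) (hsup w 1 one_pos)
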